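/- All graphs are finite and simple. A graph $G$ is $H$-free if no induced subgraph of $G$ is isomorphic to $H$. For a fixed graph $H$, an instance of $H$-free Edge Editing is a pair $(G,k)$ of a graph $G$ and an integer $k\ge 0$, and the question is whether there is a set $F$ of at most $k$ unordered pairs of distinct vertices of $G$ such that the graph $G\triangle F=(V(G),E(G)\triangle F)$ is $H$-free. In $H$-free Edge Deletion one requires moreover $F\subseteq E(G)$, and in $H$-free Edge Completion $F\cap E(G)=\emptyset$. The parameter is $k$. A linear parameterized reduction from a parameterized problem $A$ to a parameterized problem $B$ is a map, computable in time polynomial in the size of the instance (with the parameter written in unary), that takes every instance $(G',k)$ to an instance $(G,k')$ such that $(G',k)$ is a yes-instance of $A$ if and only if $(G,k')$ is a yes-instance of $B$, and $k'=O(k)$. **Lemma.** Let $H$ be a graph, let $d$ be an integer, let $V'$ be the set of vertices of $H$ of degree more than $d$, and let $H'=H[V']$ be the subgraph of $H$ induced by $V'$. Then, for each of the three kinds of modification (Editing, Deletion, Completion), there is a linear parameterized reduction from the $H'$-free problem of that kind to the $H$-free problem of the same kind. Moreover, the reduction can be chosen such that, for every instance $(G',k)$, its output graph $G$ is, up to isomorphism,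 obtained from $G'$ as follows. For every (not necessarily induced) subgraph $C$ of the complete graph on $V(G')$ that is isomorphic to $H'$, fix an isomorphism $\varphi_C\colon H'\to C$ and add $k+1$ disjoint sets of new vertices, each of them a copy of $V(H)\setminus V'$. For each such set $V_i$, add the edges within $V_i$ and between $V_i$ and $V(C)$ that correspond to the edges of $H$ with at least one end outside $V'$, where the vertices in $V'$ are identified with those of $C$ through $\varphi_C$. No other edges are added; in particular $G[V(G')]=G'$. -/

import Mathlib

open scoped symmDiff

/-! ### Edge modification problems -/

/-- `G` is `H`-free: no induced subgraph of `G` is isomorphic to `H`. -/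
def InducedFree {V W : Type*} (H : SimpleGraph V) (G : SimpleGraph W) : Prop :=
  ¬ H.IsIndContained G

/-- The three kinds of edge modification. -/
inductive ModificationKind
  | editing
  | deletion
  | completion

/-- The pairs of distinct vertices that may be modified: all of them for editing,
the edges for deletion, the non-edges for completion. -/
def ModificationKind.allowed {W : Type*} (G : SimpleGraph W) : ModificationKind → Set (Sym2 W)
  | editing => (⊤ : SimpleGraph W).edgeSet
  | deletion => G.edgeSet
  | completion => Gᶜ.edgeSet

/-- The graph `G ∆ F` with the vertices of `G` and edge set `E(G) ∆ F`. -/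
def modifyEdges {W : Type*} (G : SimpleGraph W) (F : Finset (Sym2 W)) : SimpleGraph W :=
  SimpleGraph.fromEdgeSet (G.edgeSet ∆ (F : Set (Sym2 W)))

/-- An instance `(G, k)` of a parameterized graph problem; the vertices of `G` are `0, …, n - 1`. -/
structure ParamGraph where
  n : ℕ
  graph : SimpleGraph (Fin n)
  k : ℕ

/-- The parameterized problem `H`-free Edge Editing / Deletion / Completion, as the set of its
yes-instances: at most `k` modifications of the given kind make `G` an `H`-free graph. -/
def FreeEdgeModification {V : Type*} (H : SimpleGraph V) (kind : ModificationKind) :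
    Set ParamGraph :=
  {I | ∃ F : Finset (Sym2 (Fin I.n)), (F : Set (Sym2 (Fin I.n))) ⊆ kind.allowed I.graph ∧
    F.card ≤ I.k ∧ InducedFree H (modifyEdges I.graph F)}

/-! ### Linear parameterized reductions -/

open Classical in
/-- The encoding of an instance as a word over the three letters `some true`, `some false`, `none`:
the parameter in unary, then the lower triangular adjacency matrix of the graph, where the row of
each vertex `v` is the separator `none` followed by the `v` bits that tell which of the vertices
`0, …, v - 1` are adjacent to `v`. -/
noncomputable def ParamGraph.encode (I : ParamGraph) : List (Option Bool) :=
  List.replicate I.k (some true) ++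
    (List.finRange I.n).flatMap fun v =>
      none :: ((List.finRange I.n).filter (fun u => u < v)).map
        fun u => some (decide (I.graph.Adj v u))

/-- `f` is a linear parameterized reduction from `A` to `B`: it is computed by a multi-stack Turing
machine in time polynomial in the length of the encoded instance, it maps exactly the yes-instances
of `A` to yes-instances of `B`, and the new parameter is `O(k)`. -/
def IsLinearParameterizedReduction (A B : Set ParamGraph) (f : ParamGraph → ParamGraph) : Prop :=
  Nonempty (Turing.TM2ComputableInPolyTime ParamGraph.encode ParamGraph.encode f) ∧
    (∀ I, I ∈ A ↔ f I ∈ B) ∧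
    ∃ c : ℕ, ∀ I, (f I).k ≤ c * I.k

/-! ### Attaching copies of a graph -/

/-- The copies of `H'` in the complete graph on `W`: all subgraphs (not necessarily induced) of
that complete graph that are isomorphic to `H'`. -/
def CopyInComplete {V : Type*} (H' : SimpleGraph V) (W : Type*) : Type _ :=
  {C : (⊤ : SimpleGraph W).Subgraph // Nonempty (H' ≃g C.coe)}

/-- Attach to `G'`, at every copy `C` of `H[S]` in the complete graph on the vertices of `G'`,
`r` copies of `H` that meet `G'` exactly in `C`: for each of them the vertices of `H` outside `S`
are new, and those in `S` are identified with the vertices of `C` through the isomorphism `φ C`.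
The edges within `V(G')` stay those of `G'`. -/
def attachCopies {V W : Type*} (H : SimpleGraph V) (S : Set V) (r : ℕ) (G' : SimpleGraph W)
    (φ : ∀ C : CopyInComplete (H.induce S) W, H.induce S ≃g C.1.coe) :
    SimpleGraph (W ⊕ (CopyInComplete (H.induce S) W × Fin r × ↥Sᶜ)) where
  Adj
    | .inl u, .inl v => G'.Adj u v
    | .inl u, .inr (C, _, x) => ∃ y : S, (φ C y : W) = u ∧ H.Adj y x
    | .inr (C, _, x), .inl u => ∃ y : S, (φ C y : W) = u ∧ H.Adj y x
    | .inr (C, i, x), .inr (D, j, y) => C = D ∧ i = j ∧ H.Adj x y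
  symm := ⟨by
    rintro (u | ⟨C, i, x⟩) (v | ⟨D, j, y⟩) h
    · exact SimpleGraph.Adj.symm h
    · exact h
    · exact h
    · exact ⟨h.1.symm, h.2.1.symm, SimpleGraph.Adj.symm h.2.2⟩⟩
  loopless := ⟨by
    rintro (u | ⟨C, i, x⟩) h
    · exact G'.loopless.irrefl u h
    · exact H.loopless.irrefl _ h.2.2⟩

/-!
A copy of `H` in a modification of the constructed graph that leaves the new vertices alone maps the
vertices of `V'` into `V(G')`: a new vertex plays the role of a vertex outside `V'` in the copy of
`H` attached with it, so its degree is at most `d`. Hence a solution for `G'` is a solution for the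
constructed graph. Conversely, if a set `F` of at most `k` pairs makes the constructed graph
`H`-free but leaves a copy `C` of `H'` within `V(G')`, then `F` misses all the new pairs of one of
the `k + 1` copies of `H` attached at `C`, and this copy of `H` is induced after the modification.

For the running time, `H` is fixed: the copies of `H'` in a complete graph on `n` vertices are
given by a set of `|V'|` of the vertices and one of finitely many graphs on `V'`, so there are
`O(n ^ |V'|)` of them. A stack machine enumerates the sets by placing marks in a word of length `n`,
and appends the rows of the new vertices to the encoding of its input. The copies that share a set
of vertices are distinguished by the finite control.
-/

/-! ### Edge modifications of induced subgraphs -/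

section modifyEdges

variable {W W' : Type*} {G : SimpleGraph W} {G' : SimpleGraph W'}

theorem modifyEdges_adj {F : Finset (Sym2 W)} {a b : W} :
    (modifyEdges G F).Adj a b ↔
      (G.Adj a b ∧ s(a, b) ∉ F ∨ s(a, b) ∈ F ∧ ¬ G.Adj a b) ∧ a ≠ b := by
  simp [modifyEdges, Set.mem_symmDiff]

theorem modifyEdges_adj_of_notMem {F : Finset (Sym2 W)} {a b : W} (hab : s(a, b) ∉ F) :
    (modifyEdges G F).Adj a b ↔ G.Adj a b := by
  simpa [modifyEdges_adj, hab] using SimpleGraph.Adj.ne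

/-- The embedding `j` between the modified graphs, when `F` is the restriction of `F'` along `j`. -/
def modifyEdgesEmbedding (j : G ↪g G') {F : Finset (Sym2 W)} {F' : Finset (Sym2 W')}
    (hF : ∀ e, Sym2.map j e ∈ F' ↔ e ∈ F) : modifyEdges G F ↪g modifyEdges G' F' where
  toEmbedding := j.toEmbedding
  map_rel_iff' {a b} := by
    have hab : s(j a, j b) ∈ F' ↔ s(a, b) ∈ F := hF s(a, b)
    change (modifyEdges G' F').Adj (j a) (j b) ↔ (modifyEdges G F).Adj a b
    rw [modifyEdges_adj, modifyEdges_adj, hab, j.map_adj_iff, j.injective.ne_iff]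

theorem ModificationKind.map_mem_allowed (j : G ↪g G') (kind : ModificationKind) (e : Sym2 W) :
    Sym2.map j e ∈ kind.allowed G' ↔ e ∈ kind.allowed G := by
  induction e with | _ a b
  cases kind <;> simp [ModificationKind.allowed, j.map_adj_iff, j.injective.eq_iff]

theorem InducedFree.of_embedding {V : Type*} {H : SimpleGraph V} (hG' : InducedFree H G')
    (j : G ↪g G') : InducedFree H G :=
  fun hG => hG' (hG.trans j.isIndContained)

theorem isIndContained_of_range_subset {V : Type*} {A : SimpleGraph V} (ψ : A ↪g G') (j : G ↪g G')
    (hψ : Set.range ψ ⊆ Set.range j) : A.IsIndContained G := by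
  choose g hg using fun a => hψ (Set.mem_range_self a)
  refine ⟨⟨⟨g, fun a b hab => ψ.injective ?_⟩, fun {a b} => ?_⟩⟩
  · rw [← hg a, ← hg b, hab]
  · change G.Adj (g a) (g b) ↔ A.Adj a b
    rw [← j.map_adj_iff, hg, hg, ψ.map_adj_iff]

theorem ModificationKind.exists_restriction (j : G ↪g G') {kind : ModificationKind}
    {F' : Finset (Sym2 W')} (hF' : (F' : Set (Sym2 W')) ⊆ kind.allowed G') :
    ∃ F : Finset (Sym2 W), (F : Set (Sym2 W)) ⊆ kind.allowed G ∧ F.card ≤ F'.card ∧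
      ∀ e, Sym2.map j e ∈ F' ↔ e ∈ F := by
  have hj := (Sym2.map.injective j.injective).injOn (s := Sym2.map j ⁻¹' F')
  refine ⟨F'.preimage (Sym2.map j) hj, fun e he => ?_, ?_, fun e => Finset.mem_preimage.symm⟩
  · exact (kind.map_mem_allowed j e).1 (hF' (Finset.mem_preimage.1 he))
  · exact Finset.card_le_card_of_injOn _ (fun e he => Finset.mem_preimage.1 he)
      (Sym2.map.injective j.injective).injOn

end modifyEdges

/-- `H`-freeness can be reached from `G` by at most `k` modifications of the given kind: this is
`FreeEdgeModification` for graphs on any type of vertices. -/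
def CanModify {V W : Type*} (H : SimpleGraph V) (kind : ModificationKind) (G : SimpleGraph W)
    (k : ℕ) : Prop :=
  ∃ F : Finset (Sym2 W), (F : Set (Sym2 W)) ⊆ kind.allowed G ∧ F.card ≤ k ∧
    InducedFree H (modifyEdges G F)

section CanModify

variable {V W W' : Type*} {H : SimpleGraph V} {kind : ModificationKind} {G : SimpleGraph W}
  {G' : SimpleGraph W'} {k : ℕ}

theorem CanModify.of_embedding (j : G ↪g G') (h : CanModify H kind G' k) :
    CanModify H kind G k := by
  obtain ⟨F', hF', hk, hfree⟩ := h
  obtain ⟨F, hF, hcard, hmem⟩ := ModificationKind.exists_restriction j hF'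
  exact ⟨F, hF, hcard.trans hk, hfree.of_embedding (modifyEdgesEmbedding j hmem)⟩

theorem CanModify.iso_iff (e : G ≃g G') : CanModify H kind G k ↔ CanModify H kind G' k :=
  ⟨.of_embedding e.symm.toEmbedding, .of_embedding e.toEmbedding⟩

end CanModify

/-! ### Equivalence of the two instances -/

theorem exists_copyInComplete {V W : Type*} {A : SimpleGraph V} {B : SimpleGraph W} (ψ : A ↪g B) :
    ∃ C : CopyInComplete A W, ∀ (φ : A ≃g C.1.coe) (a b : V),
      B.Adj (φ a) (φ b) ↔ A.Adj a b := by
  let ψ' : A.Copy (⊤ : SimpleGraph W) := ⟨⟨ψ, fun h => ψ.injective.ne h.ne⟩, ψ.injective⟩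
  refine ⟨⟨ψ'.toSubgraph, ⟨ψ'.isoToSubgraph⟩⟩, fun φ a b => ?_⟩
  obtain ⟨a', -, ha⟩ := (φ a).2
  obtain ⟨b', -, hb⟩ := (φ b).2
  rw [← φ.map_adj_iff, SimpleGraph.Subgraph.coe_adj, ← ha, ← hb]
  change B.Adj (ψ a') (ψ b') ↔ ψ'.toSubgraph.Adj (ψ a') (ψ b')
  rw [ψ.map_adj_iff]
  constructor
  · exact fun hadj => ⟨a', b', hadj, rfl, rfl⟩
  · rintro ⟨x, y, hadj, hx, hy⟩
    rwa [← ψ.injective hx, ← ψ.injective hy]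

section attachCopies

variable {V W : Type*} (H : SimpleGraph V) (S : Set V) (r : ℕ) (G' : SimpleGraph W)
  (φ : ∀ C : CopyInComplete (H.induce S) W, H.induce S ≃g C.1.coe)

/-- `G'` as an induced subgraph of the graph with attached copies. -/
def attachCopiesInl : G' ↪g attachCopies H S r G' φ where
  toFun := Sum.inl
  inj' := Sum.inl_injective
  map_rel_iff' := Iff.rfl

open Classical in
/-- The vertex that plays the role of `v` in the `i`-th copy of `H` attached at `C`. -/
noncomputable def attachedCopy (C : CopyInComplete (H.induce S) W) (i : Fin r) (v : V) :
    W ⊕ (CopyInComplete (H.induce S) W × Fin r × ↥Sᶜ) :=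
  if hv : v ∈ S then .inl (φ C ⟨v, hv⟩) else .inr (C, i, ⟨v, hv⟩)

variable {H S r G' φ} {C : CopyInComplete (H.induce S) W} {i : Fin r} {v w : V}

theorem attachedCopy_of_mem (hv : v ∈ S) :
    attachedCopy H S r φ C i v = .inl (φ C ⟨v, hv⟩ : W) := dif_pos hv

theorem attachedCopy_of_notMem (hv : v ∉ S) :
    attachedCopy H S r φ C i v = .inr (C, i, ⟨v, hv⟩) := dif_neg hv

theorem attachedCopy_injective : Function.Injective (attachedCopy H S r φ C i) := by
  intro v w hvw
  by_cases hv : v ∈ S <;> by_cases hw : w ∈ S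
  · rw [attachedCopy_of_mem hv, attachedCopy_of_mem hw] at hvw
    exact congrArg Subtype.val ((φ C).injective (Subtype.ext (Sum.inl_injective hvw)))
  · simp [attachedCopy_of_mem hv, attachedCopy_of_notMem hw] at hvw
  · simp [attachedCopy_of_notMem hv, attachedCopy_of_mem hw] at hvw
  · simpa [attachedCopy_of_notMem hv, attachedCopy_of_notMem hw] using hvw

theorem attachCopies_adj_attachedCopy (hv : v ∉ S) :
    (attachCopies H S r G' φ).Adj (attachedCopy H S r φ C i v) (attachedCopy H S r φ C i w) ↔
      H.Adj v w := by
  rw [attachedCopy_of_notMem hv]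
  by_cases hw : w ∈ S
  · rw [attachedCopy_of_mem hw]
    constructor
    · rintro ⟨y, hy, hadj⟩
      obtain rfl : y = ⟨w, hw⟩ := (φ C).injective (Subtype.ext hy)
      exact hadj.symm
    · exact fun hadj => ⟨⟨w, hw⟩, rfl, hadj.symm⟩
  · rw [attachedCopy_of_notMem hw]
    exact ⟨fun hadj => hadj.2.2, fun hadj => ⟨rfl, rfl, hadj⟩⟩

theorem exists_eq_attachedCopy_of_adj {x : ↥Sᶜ}
    {a : W ⊕ (CopyInComplete (H.induce S) W × Fin r × ↥Sᶜ)}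
    (hadj : (attachCopies H S r G' φ).Adj (.inr (C, i, x)) a) :
    ∃ w, H.Adj x w ∧ attachedCopy H S r φ C i w = a := by
  rcases a with u | ⟨D, j, y⟩
  · obtain ⟨y, hy, hadj⟩ := hadj
    exact ⟨y, hadj.symm, by rw [attachedCopy_of_mem y.2, ← hy]⟩
  · obtain ⟨rfl, rfl, hadj⟩ := hadj
    exact ⟨y, hadj, attachedCopy_of_notMem y.2⟩

theorem notMem_map_attachCopiesInl {F : Finset (Sym2 W)}
    {p : CopyInComplete (H.induce S) W × Fin r × ↥Sᶜ}
    {a : W ⊕ (CopyInComplete (H.induce S) W × Fin r × ↥Sᶜ)} :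
    s(.inr p, a) ∉ F.map (attachCopiesInl H S r G' φ).toEmbedding.sym2Map := by
  intro hmem
  obtain ⟨e, -, he⟩ := Finset.mem_map.1 hmem
  have hp : .inr p ∈ Sym2.map (attachCopiesInl H S r G' φ) e := by
    rw [show Sym2.map (attachCopiesInl H S r G' φ) e = s(.inr p, a) from he]
    exact Sym2.mem_mk_left _ _
  obtain ⟨u, -, hu⟩ := Sym2.mem_map.1 hp
  exact Sum.inl_ne_inr hu

open Classical in
theorem degree_le_of_eq_inr [Fintype V] [DecidableRel H.Adj] {F : Finset (Sym2 W)}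
    (ψ : H ↪g modifyEdges (attachCopies H S r G' φ)
      (F.map (attachCopiesInl H S r G' φ).toEmbedding.sym2Map))
    {x : ↥Sᶜ} (hv : ψ v = .inr (C, i, x)) : H.degree v ≤ H.degree x := by
  have hsub : (H.neighborFinset v).image ψ ⊆
      (H.neighborFinset x).image (attachedCopy H S r φ C i) := by
    intro a ha
    simp only [Finset.mem_image, SimpleGraph.mem_neighborFinset] at ha ⊢
    obtain ⟨w, hw, rfl⟩ := ha
    rw [← ψ.map_adj_iff, hv, modifyEdges_adj_of_notMem notMem_map_attachCopiesInl] at hw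
    exact exists_eq_attachedCopy_of_adj hw
  have hcard := Finset.card_le_card hsub
  rwa [Finset.card_image_of_injective _ ψ.injective,
    Finset.card_image_of_injective _ attachedCopy_injective,
    SimpleGraph.card_neighborFinset_eq_degree, SimpleGraph.card_neighborFinset_eq_degree] at hcard

theorem CanModify.attachCopies [Fintype V] [DecidableRel H.Adj]
    (hS : ∀ v ∈ S, ∀ x ∉ S, H.degree x < H.degree v) {kind : ModificationKind} {k : ℕ}
    (h : CanModify (H.induce S) kind G' k) : CanModify H kind (attachCopies H S r G' φ) k := by
  obtain ⟨F, hF, hk, hfree⟩ := h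
  let J := attachCopiesInl H S r G' φ
  refine ⟨F.map J.toEmbedding.sym2Map, ?_, by rwa [Finset.card_map], ?_⟩
  · rw [Finset.coe_map]
    rintro _ ⟨e, he, rfl⟩
    exact (kind.map_mem_allowed J e).2 (hF he)
  · rintro ⟨ψ⟩
    refine hfree (isIndContained_of_range_subset (ψ.comp (SimpleGraph.Embedding.induce S))
      (modifyEdgesEmbedding J fun e => Finset.mem_map' J.toEmbedding.sym2Map) ?_)
    rintro _ ⟨v, rfl⟩
    change ψ v ∈ Set.range Sum.inl
    rcases hv : ψ v with u | ⟨C, i, x⟩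
    · exact ⟨u, rfl⟩
    · exact absurd (degree_le_of_eq_inr ψ hv) (hS v v.2 x x.2).not_ge

theorem eq_of_sym2_attachedCopy_eq {j : Fin r} {v' w' : V} (hv : v ∉ S)
    (heq : s(attachedCopy H S r φ C i v, attachedCopy H S r φ C i w) =
      s(attachedCopy H S r φ C j v', attachedCopy H S r φ C j w')) : i = j := by
  have eq_of_eq_attachedCopy {u : V}
      (hu : attachedCopy H S r φ C i v = attachedCopy H S r φ C j u) : i = j := by
    by_cases huS : u ∈ S
    · simp [attachedCopy_of_notMem hv, attachedCopy_of_mem huS] at hu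
    · simp only [attachedCopy_of_notMem hv, attachedCopy_of_notMem huS, Sum.inr.injEq,
        Prod.mk.injEq] at hu
      exact hu.2.1
  have hmem := Sym2.mem_mk_left (attachedCopy H S r φ C i v) (attachedCopy H S r φ C i w)
  rw [heq, Sym2.mem_iff] at hmem
  exact hmem.elim eq_of_eq_attachedCopy eq_of_eq_attachedCopy

theorem exists_attachedCopy_notMem
    {F : Finset (Sym2 (W ⊕ (CopyInComplete (H.induce S) W × Fin r × ↥Sᶜ)))} (hF : F.card < r)
    (C : CopyInComplete (H.induce S) W) :
    ∃ i : Fin r, ∀ v ∉ S, ∀ w,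
      s(attachedCopy H S r φ C i v, attachedCopy H S r φ C i w) ∉ F := by
  by_contra! hcon
  choose v hv w hvw using hcon
  have hcard := Finset.card_le_card_of_injOn (s := Finset.univ) (t := F) _
    (fun i _ => hvw i) fun i _ j _ => eq_of_sym2_attachedCopy_eq (hv i)
  rw [Finset.card_univ, Fintype.card_fin] at hcard
  omega

theorem isIndContained_modifyEdges_attachCopies
    {F : Finset (Sym2 (W ⊕ (CopyInComplete (H.induce S) W × Fin r × ↥Sᶜ)))}
    (hC : ∀ y z : S, (modifyEdges (attachCopies H S r G' φ) F).Adj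
      (.inl (φ C y : W)) (.inl (φ C z : W)) ↔ H.Adj y z)
    (hF : ∀ v ∉ S, ∀ w, s(attachedCopy H S r φ C i v, attachedCopy H S r φ C i w) ∉ F) :
    H.IsIndContained (modifyEdges (attachCopies H S r G' φ) F) := by
  refine ⟨⟨⟨attachedCopy H S r φ C i, attachedCopy_injective⟩, fun {v w} => ?_⟩⟩
  change (modifyEdges _ F).Adj (attachedCopy H S r φ C i v) (attachedCopy H S r φ C i w) ↔ _
  by_cases hv : v ∈ S
  · by_cases hw : w ∈ S
    · rw [attachedCopy_of_mem hv, attachedCopy_of_mem hw]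
      exact hC ⟨v, hv⟩ ⟨w, hw⟩
    · rw [SimpleGraph.adj_comm, modifyEdges_adj_of_notMem (hF w hw v),
        attachCopies_adj_attachedCopy hw, SimpleGraph.adj_comm]
  · rw [modifyEdges_adj_of_notMem (hF v hv w), attachCopies_adj_attachedCopy hv]

theorem CanModify.of_attachCopies {kind : ModificationKind} {k : ℕ} (hk : k < r)
    (h : CanModify H kind (_root_.attachCopies H S r G' φ) k) :
    CanModify (H.induce S) kind G' k := by
  obtain ⟨F', hF', hcard', hfree⟩ := h
  let J := attachCopiesInl H S r G' φ
  obtain ⟨F, hF, hcard, hmem⟩ := ModificationKind.exists_restriction J hF'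
  refine ⟨F, hF, hcard.trans hcard', ?_⟩
  rintro ⟨ψ⟩
  obtain ⟨C, hC⟩ := exists_copyInComplete ψ
  obtain ⟨i, hi⟩ := exists_attachedCopy_notMem (φ := φ) (hcard'.trans_lt hk) C
  refine hfree (isIndContained_modifyEdges_attachCopies (fun y z => ?_) hi)
  exact (modifyEdgesEmbedding J hmem).map_adj_iff.trans (hC (φ C) y z)

end attachCopies

/-! ### Structured programs for stack machines -/

/-- Structured programs for machines with stacks indexed by `K` over the alphabet `Γ`. They are
compiled to the machines of `Turing.TM2`. The program `loop s c f` pops symbols `a` from the stack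
`s` and runs `f a`, as long as the top of `s` is a symbol that satisfies `c`. -/
inductive StackProg (K Γ : Type) : Type
  | skip : StackProg K Γ
  | push (s : K) (a : Γ) : StackProg K Γ
  | pop (s : K) : StackProg K Γ
  | seq (p q : StackProg K Γ) : StackProg K Γ
  | loop (s : K) (c : Γ → Bool) (f : Γ → StackProg K Γ) : StackProg K Γ

namespace StackProg

variable {K Γ : Type}

/-- The labels of the machine instructions of a program. -/
def Label : StackProg K Γ → Type
  | skip => Unit
  | push _ _ => Unit
  | pop _ => Unit
  | seq p q => Label p ⊕ Label q
  | loop _ _ f => Option (Σ a, Label (f a))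

/-- The label of the first instruction. -/
def entry : (p : StackProg K Γ) → Label p
  | skip => ()
  | push _ _ => ()
  | pop _ => ()
  | seq p _ => Sum.inl (entry p)
  | loop _ _ _ => none

@[reducible]
noncomputable def fintypeLabel [Fintype Γ] : (p : StackProg K Γ) → Fintype (Label p)
  | skip => inferInstanceAs (Fintype Unit)
  | push _ _ => inferInstanceAs (Fintype Unit)
  | pop _ => inferInstanceAs (Fintype Unit)
  | seq p q =>
    letI := fintypeLabel p
    letI := fintypeLabel q
    inferInstanceAs (Fintype (Label p ⊕ Label q))
  | loop _ _ f =>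
    letI := fun a => fintypeLabel (f a)
    inferInstanceAs (Fintype (Option (Σ a, Label (f a))))

/-- The machine instructions of a program whose labels are embedded by `e` and which continues
at `x`. The popped symbol is kept in the internal state of type `Option Γ`, where `goto` can read
it. -/
def code {Λ : Type} : (p : StackProg K Γ) → (Label p → Λ) → Λ → Label p →
    Turing.TM2.Stmt (fun _ : K => Γ) Λ (Option Γ)
  | skip, _, x, _ => .goto fun _ => x
  | push s a, _, x, _ => .push s (fun _ => a) (.goto fun _ => x)
  | pop s, _, x, _ => .pop s (fun v _ => v) (.goto fun _ => x)
  | seq p q, e, _, Sum.inl l => code p (fun l => e (Sum.inl l)) (e (Sum.inr (entry q))) l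
  | seq _ q, e, x, Sum.inr l => code q (fun l => e (Sum.inr l)) x l
  | loop s c f, e, x, none =>
    .peek s (fun _ o => o) <| .branch (fun v => v.any c)
      (.pop s (fun v _ => v) <| .goto fun v => match v with
        | some a => e (some ⟨a, entry (f a)⟩)
        | none => x)
      (.goto fun _ => x)
  | loop _ _ f, e, _, some ⟨a, l⟩ => code (f a) (fun l => e (some ⟨a, l⟩)) (e none) l

variable [DecidableEq K]

/-- `Exec p S S' t`: started with the stacks `S`, the program `p` ends with the stacks `S'` within
`t` steps. -/
inductive Exec : StackProg K Γ → (K → List Γ) → (K → List Γ) → ℕ → Prop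
  | skip {S} : Exec skip S S 1
  | push {s a S} : Exec (push s a) S (Function.update S s (a :: S s)) 1
  | pop {s S} : Exec (pop s) S (Function.update S s (S s).tail) 1
  | seq {p q S S' S'' t t'} : Exec p S S' t → Exec q S' S'' t' → Exec (seq p q) S S'' (t + t')
  | loop_exit {s c f S} : (∀ a ∈ (S s).head?, c a = false) → Exec (loop s c f) S S 1
  | loop_step {s c f S S' S'' a l t t'} : S s = a :: l → c a = true →
      Exec (f a) (Function.update S s l) S' t → Exec (loop s c f) S' S'' t' →
      Exec (loop s c f) S S'' (1 + t + t')
  | mono {p S S' t t'} : Exec p S S' t → t ≤ t' → Exec p S S' t'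

section Simulation

open StateTransition Turing

theorem Exec.evalsToInTime {Λ : Type} (M : Λ → TM2.Stmt (fun _ : K => Γ) Λ (Option Γ))
    {p : StackProg K Γ} {S S' : K → List Γ} {t : ℕ} (h : Exec p S S' t) :
    ∀ (e : Label p → Λ) (x : Λ), (∀ l, M (e l) = code p e x l) → ∀ v, ∃ v',
      Nonempty (EvalsToInTime (TM2.step M) ⟨some (e (entry p)), v, S⟩
        (some ⟨some x, v', S'⟩) t) := by
  induction h with
  | skip => exact fun e x hM v => ⟨v, ⟨⟨1, by simp [flip, hM, code]⟩, le_rfl⟩⟩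
  | push => exact fun e x hM v => ⟨v, ⟨⟨1, by simp [flip, hM, code]⟩, le_rfl⟩⟩
  | pop => exact fun e x hM v => ⟨v, ⟨⟨1, by simp [flip, hM, code]⟩, le_rfl⟩⟩
  | @seq p q S S' S'' t t' _ _ ihp ihq =>
    intro e x hM v
    obtain ⟨v₁, ⟨runp⟩⟩ := ihp (fun l => e (.inl l)) (e (.inr (entry q))) (fun l => hM (.inl l)) v
    obtain ⟨v₂, ⟨runq⟩⟩ := ihq (fun l => e (.inr l)) x (fun l => hM (.inr l)) v₁
    rw [add_comm]
    exact ⟨v₂, ⟨runp.trans _ _ _ _ _ _ runq⟩⟩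
  | @loop_exit s c f S hS =>
    intro e x hM v
    have hany : (S s).head?.any c = false := by
      cases htop : (S s).head? with
      | none => rfl
      | some a => exact hS a htop
    refine ⟨(S s).head?, ⟨⟨1, ?_⟩, le_rfl⟩⟩
    simp [flip, entry, show M (e none) = _ from hM none, code, hany]
  | @loop_step s c f S S' S'' a l t t' hS ha _ _ ihbody ihloop =>
    intro e x hM v
    have pop : EvalsToInTime (TM2.step M) ⟨some (e (entry (loop s c f))), v, S⟩
        (some ⟨some (e (some ⟨a, entry (f a)⟩)), some a, Function.update S s l⟩) 1 := by
      refine ⟨⟨1, ?_⟩, le_rfl⟩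
      simp [flip, entry, show M (e none) = _ from hM none, code, hS, ha]
    obtain ⟨v₁, ⟨body⟩⟩ := ihbody (fun l => e (some ⟨a, l⟩)) (e none)
      (fun l => hM (some ⟨a, l⟩)) (some a)
    obtain ⟨v₂, ⟨rest⟩⟩ := ihloop e x hM v₁
    have run := pop.trans _ _ _ _ _ _ (body.trans _ _ _ _ _ _ rest)
    exact ⟨v₂, ⟨⟨run.toEvalsTo, run.steps_le_m.trans (by omega)⟩⟩⟩
  | mono _ hle ih =>
    intro e x hM v
    obtain ⟨v', ⟨run⟩⟩ := ih e x hM v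
    exact ⟨v', ⟨⟨run.toEvalsTo, run.steps_le_m.trans hle⟩⟩⟩

/-- The machine that runs the program `p` with `s` as its input and output stack. Its additional
label `none` clears the internal state before halting, since a machine of type `FinTM2` has to halt
in its initial internal state. -/
noncomputable def toFinTM2 [Fintype K] [Fintype Γ] (p : StackProg K Γ) (s : K) : FinTM2 where
  K := K
  k₀ := s
  k₁ := s
  Γ := fun _ => Γ
  Λ := Option (Label p)
  main := some (entry p)
  ΛFin := letI := fintypeLabel p; inferInstance
  σ := Option Γ
  initialState := none
  Γk₀Fin := inferInstanceAs (Fintype Γ)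
  m
    | none => .load (fun _ => none) .halt
    | some l => code p some none l

theorem outputsInTime_toFinTM2 [Fintype K] [Fintype Γ] {p : StackProg K Γ} {s : K}
    {w w' : List Γ} {t : ℕ}
    (h : Exec p (Function.update (fun _ => []) s w) (Function.update (fun _ => []) s w') t) :
    Nonempty (TM2OutputsInTime (p.toFinTM2 s) w (some w') (t + 1)) := by
  have stk_eq (u : List Γ) : (fun k : K => dite (k = s) (fun _ => u) fun _ => []) =
      Function.update (fun _ : K => ([] : List Γ)) s u := by
    funext k
    by_cases hk : k = s <;> simp [hk]
  obtain ⟨v, ⟨run⟩⟩ := h.evalsToInTime (p.toFinTM2 s).m some none (fun l => rfl) none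
  rw [← stk_eq w, ← stk_eq w'] at run
  have halt : EvalsToInTime (TM2.step (p.toFinTM2 s).m)
      ⟨some none, v, fun k : K => dite (k = s) (fun _ => w') fun _ => []⟩
      (some (haltList (p.toFinTM2 s) w')) 1 := ⟨⟨1, rfl⟩, le_rfl⟩
  have total := run.trans _ _ _ _ _ _ halt
  rw [add_comm] at total
  exact ⟨total⟩

end Simulation

theorem Exec.congr {p : StackProg K Γ} {S S' S'' : K → List Γ} {t t' : ℕ} (h : Exec p S S' t)
    (hS : S' = S'') (ht : t ≤ t') : Exec p S S'' t' :=
  hS ▸ h.mono ht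

theorem Exec.push_of_eq {s : K} {a : Γ} {S S' : K → List Γ}
    (h : Function.update S s (a :: S s) = S') : Exec (.push s a) S S' 1 :=
  h ▸ .push

/-- Move the symbols that satisfy `c` from the top of `s` to `t`. -/
def move (s t : K) (c : Γ → Bool) : StackProg K Γ := loop s c fun x => push t x

/-- Move the symbols that satisfy `c` from the top of `s` to `t`, and push `y x` onto `o` for each
such symbol `x`. -/
def scan (s t o : K) (c : Γ → Bool) (y : Γ → Γ) : StackProg K Γ :=
  loop s c fun x => seq (push t x) (push o (y x))

/-- Empty the stack `s`. -/
def clear (s : K) : StackProg K Γ := loop s (fun _ => true) fun _ => skip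

/-- Run the programs `f x` for the elements `x` of a list, one after the other. -/
def forEach {α : Type*} (f : α → StackProg K Γ) : List α → StackProg K Γ
  | [] => skip
  | x :: l => seq (f x) (forEach f l)

theorem exec_move {s t : K} (hst : s ≠ t) {c : Γ → Bool} {r : List Γ}
    (hr : ∀ x ∈ r.head?, c x = false) (l : List Γ) :
    ∀ S : K → List Γ, S s = l ++ r → (∀ x ∈ l, c x = true) →
      Exec (move s t c) S
        (Function.update (Function.update S s r) t (l.reverse ++ S t)) (2 * l.length + 1) := by
  induction l with
  | nil =>
    intro S hS _
    refine (Exec.loop_exit (by simpa [hS] using hr)).congr ?_ (by simp)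
    funext k
    by_cases hkt : k = t <;> by_cases hks : k = s <;> simp_all
  | cons x l ih =>
    intro S hS hc
    refine (Exec.loop_step hS (hc x (by simp)) Exec.push
      (ih _ ?_ fun y hy => hc y (by simp [hy]))).congr ?_ (by simp; omega)
    · simp [Function.update_of_ne hst]
    · funext k
      by_cases hkt : k = t <;> by_cases hks : k = s <;> simp_all

theorem exec_scan {s t o : K} (hst : s ≠ t) (hso : s ≠ o) (hto : t ≠ o) {c : Γ → Bool}
    {y : Γ → Γ} {r : List Γ} (hr : ∀ x ∈ r.head?, c x = false) (l : List Γ) :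
    ∀ S : K → List Γ, S s = l ++ r → (∀ x ∈ l, c x = true) →
      Exec (scan s t o c y) S
        (Function.update (Function.update (Function.update S s r) t (l.reverse ++ S t)) o
          ((l.map y).reverse ++ S o)) (3 * l.length + 1) := by
  induction l with
  | nil =>
    intro S hS _
    refine (Exec.loop_exit (by simpa [hS] using hr)).congr ?_ (by simp)
    funext k
    by_cases hkt : k = t <;> by_cases hks : k = s <;> by_cases hko : k = o <;> simp_all
  | cons x l ih =>
    intro S hS hc
    refine (Exec.loop_step hS (hc x (by simp)) (Exec.seq Exec.push Exec.push)
      (ih _ ?_ fun y hy => hc y (by simp [hy]))).congr ?_ (by simp; omega)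
    · simp [Function.update_of_ne hst, Function.update_of_ne hso]
    · funext k
      by_cases hkt : k = t <;> by_cases hks : k = s <;> by_cases hko : k = o <;>
        simp_all [Function.update_of_ne hto.symm]

theorem exec_clear (s : K) (S : K → List Γ) :
    Exec (clear s) S (Function.update S s []) (2 * (S s).length + 1) := by
  generalize hl : S s = l
  induction l generalizing S with
  | nil => exact (Exec.loop_exit (by simp [hl])).congr (by simp [← hl]) (by simp)
  | cons x l ih =>
    exact (Exec.loop_step hl rfl Exec.skip (ih _ (by simp))).congr (by simp) (by simp; omega)

/-- The program `p` leads from the stacks `S` to the stacks `S'` within `T` steps and `c` further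
steps for every symbol by which the stack `o` grows. As these bounds add up under composition, the
time of a program that mainly writes onto `o` need not be summed over its parts. -/
def AmortizedExec (o : K) (c : ℕ) (p : StackProg K Γ) (S S' : K → List Γ) (T : ℕ) : Prop :=
  ∃ t, Exec p S S' t ∧ t + c * (S o).length ≤ T + c * (S' o).length

theorem Exec.amortized {p : StackProg K Γ} {S S' : K → List Γ} {t c T : ℕ} {o : K}
    (h : Exec p S S' t) (ht : t + c * (S o).length ≤ T + c * (S' o).length) :
    AmortizedExec o c p S S' T :=
  ⟨t, h, ht⟩

theorem Exec.amortized_of_eq {p : StackProg K Γ} {S S' : K → List Γ} {t c : ℕ} {o : K}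
    (h : Exec p S S' t) (ho : S' o = S o) : AmortizedExec o c p S S' t :=
  ⟨t, h, by rw [ho]⟩

namespace AmortizedExec

variable {o : K} {c T T' : ℕ} {p q : StackProg K Γ} {S S' S'' : K → List Γ}

theorem congr (h : AmortizedExec o c p S S' T) (hS : S' = S'') (hT : T ≤ T') :
    AmortizedExec o c p S S'' T' := by
  obtain ⟨t, ht, hle⟩ := h
  exact ⟨t, hS ▸ ht, by subst hS; omega⟩

theorem seq (h : AmortizedExec o c p S S' T) (h' : AmortizedExec o c q S' S'' T') :
    AmortizedExec o c (seq p q) S S'' (T + T') := by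
  obtain ⟨t, ht, hle⟩ := h
  obtain ⟨t', ht', hle'⟩ := h'
  exact ⟨t + t', ht.seq ht', by omega⟩

theorem loop_step {s : K} {d : Γ → Bool} {f : Γ → StackProg K Γ} {a : Γ} {l : List Γ}
    (hso : s ≠ o) (hS : S s = a :: l) (ha : d a = true)
    (h : AmortizedExec o c (f a) (Function.update S s l) S' T)
    (h' : AmortizedExec o c (loop s d f) S' S'' T') :
    AmortizedExec o c (loop s d f) S S'' (1 + T + T') := by
  obtain ⟨t, ht, hle⟩ := h
  obtain ⟨t', ht', hle'⟩ := h'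
  rw [Function.update_of_ne hso.symm] at hle
  exact ⟨1 + t + t', .loop_step hS ha ht ht', by omega⟩

theorem forEach {α : Type*} {f : α → StackProg K Γ} (I : List α → K → List Γ)
    (hf : ∀ l x, AmortizedExec o c (f x) (I l) (I (l ++ [x])) T) (l : List α) :
    ∀ done : List α,
      AmortizedExec o c (forEach f l) (I done) (I (done ++ l)) (l.length * T + 1) := by
  induction l with
  | nil => exact fun done => ⟨1, Exec.skip.congr (by simp) le_rfl, by simp⟩
  | cons x l ih =>
    intro done
    refine ((hf done x).seq (ih (done ++ [x]))).congr (by simp) ?_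
    rw [List.length_cons, add_mul, one_mul]
    omega

end AmortizedExec

end StackProg

/-! ### Words of marks -/

/-- Replace the successive marks `true` of a word `w` by the bits of a list (by `false` once these
are used up) and keep the unmarked letters `false`. If `w` marks a set of vertices and the list
tells which marked vertices are adjacent to a new vertex, then this is the row of adjacencies of the
new vertex. -/
def fillMarks : List Bool → List Bool → List Bool
  | _, [] => []
  | bs, false :: w => false :: fillMarks bs w
  | bs, true :: w => bs.headD false :: fillMarks bs.tail w

@[simp]
theorem length_fillMarks (bs w : List Bool) : (fillMarks bs w).length = w.length := by
  induction w generalizing bs with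
  | nil => rfl
  | cons c w ih => cases c <;> simp [fillMarks, ih]

theorem fillMarks_replicate_false (bs : List Bool) (m : ℕ) :
    fillMarks bs (List.replicate m false) = List.replicate m false := by
  induction m with
  | zero => rfl
  | succ m ih => simp [List.replicate_succ, fillMarks, ih]

theorem fillMarks_replicate_append_cons (b : Bool) (bs w : List Bool) (m : ℕ) :
    fillMarks (b :: bs) (List.replicate m false ++ true :: w) =
      List.replicate m false ++ b :: fillMarks bs w := by
  induction m with
  | zero => rfl
  | succ m ih => simp [List.replicate_succ, fillMarks, ih]

theorem getElem_fillMarks (bs w : List Bool) (u : ℕ) (hu : u < w.length) :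
    (fillMarks bs w)[u]'(by simpa using hu) =
      (w[u] && bs.getD ((w.take u).count true) false) := by
  induction w generalizing bs u with
  | nil => simp at hu
  | cons c w ih =>
    cases u with
    | zero => cases c <;> cases bs <;> simp [fillMarks]
    | succ u =>
      have hrec bs := ih bs u (by simpa using hu)
      cases c <;> cases bs <;> simp [fillMarks, hrec]

theorem eq_replicate_false_of_count_true {w : List Bool} (h : w.count true = 0) :
    w = List.replicate w.length false := by
  refine List.eq_replicate_iff.2 ⟨rfl, fun c hc => ?_⟩
  cases c with
  | false => rfl
  | true => exact absurd hc (List.count_eq_zero.1 h)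

theorem exists_eq_replicate_append_cons {w : List Bool} {n : ℕ} (h : w.count true = n + 1) :
    ∃ m w', w = List.replicate m false ++ true :: w' ∧ w'.count true = n := by
  induction w with
  | nil => simp at h
  | cons c w ih =>
    cases c with
    | true => exact ⟨0, w, rfl, by simpa using h⟩
    | false =>
      obtain ⟨m, w', hw, hn⟩ := ih (by simpa using h)
      exact ⟨m + 1, w', by simp [hw, List.replicate_succ], hn⟩

/-- The words of length `m` with `j` marks, in the order in which the machine runs through them. -/
def markWords : ℕ → ℕ → List (List Bool)
  | 0, m => [List.replicate m false]
  | _ + 1, 0 => []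
  | j + 1, m + 1 => (markWords j m).map (· ++ [true]) ++ (markWords (j + 1) m).map (· ++ [false])

theorem mem_markWords {j m : ℕ} {w : List Bool} :
    w ∈ markWords j m ↔ w.length = m ∧ w.count true = j := by
  induction m generalizing j w with
  | zero => cases j <;> cases w <;> simp [markWords]
  | succ m ih =>
    cases j with
    | zero =>
      simp only [markWords, List.mem_singleton]
      constructor
      · rintro rfl
        simp [List.count_replicate]
      · rintro ⟨hlen, hcount⟩
        rw [eq_replicate_false_of_count_true hcount, hlen]
    | succ j =>
      simp only [markWords, List.mem_append, List.mem_map, ih]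
      constructor
      · rintro (⟨w, ⟨hlen, hcount⟩, rfl⟩ | ⟨w, ⟨hlen, hcount⟩, rfl⟩) <;> simp [hlen, hcount]
      · rintro ⟨hlen, hcount⟩
        induction w using List.reverseRecOn with
        | nil => simp at hlen
        | append_singleton w c _ =>
          cases c
          · exact Or.inr ⟨w, ⟨by simpa using hlen, by simpa using hcount⟩, rfl⟩
          · exact Or.inl ⟨w, ⟨by simpa using hlen, by simpa using hcount⟩, rfl⟩

theorem nodup_markWords (j m : ℕ) : (markWords j m).Nodup := by
  induction m generalizing j with
  | zero => cases j <;> simp [markWords]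
  | succ m ih =>
    cases j with
    | zero => simp [markWords]
    | succ j =>
      refine List.Nodup.append ((ih j).map (List.append_left_injective _))
        ((ih (j + 1)).map (List.append_left_injective _)) fun w hw hw' => ?_
      obtain ⟨v, -, rfl⟩ := List.mem_map.1 hw
      obtain ⟨v', -, hv⟩ := List.mem_map.1 hw'
      simpa using congrArg List.getLast? hv

theorem length_markWords_le (j m : ℕ) : (markWords j m).length ≤ (m + 1) ^ j := by
  induction m generalizing j with
  | zero => cases j <;> simp [markWords]
  | succ m ih =>
    cases j with
    | zero => simp [markWords]
    | succ j =>
      simp only [markWords, List.length_append, List.length_map]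
      calc (markWords j m).length + (markWords (j + 1) m).length
          ≤ (m + 1) ^ j + (m + 1) ^ (j + 1) := add_le_add (ih j) (ih (j + 1))
        _ = (m + 1 + 1) * (m + 1) ^ j := by ring
        _ ≤ (m + 1 + 1) * (m + 1 + 1) ^ j := by gcongr; omega
        _ = (m + 1 + 1) ^ (j + 1) := by ring

/-! ### The machine that attaches the new vertices -/

/-- The stacks of the machine: the input and output, the graph under construction (in reverse), the
marked and unmarked part of the word of marks, the parameter, and the number of new vertices so far
in unary. Programs for which `inp` or `rest` is empty use them as scratch space. -/
inductive AttachStack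
  | inp | out | word | rest | par | cnt
  deriving DecidableEq

namespace AttachStack

instance : Fintype AttachStack where
  elems := {.inp, .out, .word, .rest, .par, .cnt}
  complete s := by cases s <;> decide

/-- The configuration of the machine with given contents of the stacks. -/
def conf (i o w r p c : List (Option Bool)) : AttachStack → List (Option Bool)
  | inp => i
  | out => o
  | word => w
  | rest => r
  | par => p
  | cnt => c

variable (i o w r p c l : List (Option Bool))

@[simp] theorem conf_inp : conf i o w r p c inp = i := rfl
@[simp] theorem conf_out : conf i o w r p c out = o := rfl
@[simp] theorem conf_word : conf i o w r p c word = w := rfl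
@[simp] theorem conf_rest : conf i o w r p c rest = r := rfl
@[simp] theorem conf_par : conf i o w r p c par = p := rfl
@[simp] theorem conf_cnt : conf i o w r p c cnt = c := rfl

@[simp] theorem update_inp : Function.update (conf i o w r p c) inp l = conf l o w r p c := by
  funext s; cases s <;> rfl
@[simp] theorem update_out : Function.update (conf i o w r p c) out l = conf i l w r p c := by
  funext s; cases s <;> rfl
@[simp] theorem update_word : Function.update (conf i o w r p c) word l = conf i o l r p c := by
  funext s; cases s <;> rfl
@[simp] theorem update_rest : Function.update (conf i o w r p c) rest l = conf i o w l p c := by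
  funext s; cases s <;> rfl
@[simp] theorem update_par : Function.update (conf i o w r p c) par l = conf i o w r l c := by
  funext s; cases s <;> rfl
@[simp] theorem update_cnt : Function.update (conf i o w r p c) cnt l = conf i o w r p l := by
  funext s; cases s <;> rfl

theorem update_nil_inp : Function.update (fun _ => []) inp l = conf l [] [] [] [] [] := by
  funext s; cases s <;> rfl

end AttachStack

open AttachStack StackProg

/-- Programs for the machine that attaches new vertices. -/
abbrev AttachProg := StackProg AttachStack (Option Bool)

namespace AttachProg

/-- Push the word `fillMarks bs w` onto `out`, where `w` is the word on `word`, and move `w` to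
`rest`. -/
def emitMarks : List Bool → AttachProg
  | [] => scan word rest out (fun _ => true) fun _ => some false
  | b :: bs => seq (scan word rest out (fun x => x != some true) fun _ => some false) <|
      seq (pop word) <| seq (push rest (some true)) <| seq (push out (some b)) <| emitMarks bs

theorem exec_emitMarks (bs : List Bool) : ∀ (w : List Bool) (i o r p c : List (Option Bool)),
    w.count true = bs.length → Exec (emitMarks bs) (conf i o (w.map some) r p c)
      (conf i (((fillMarks bs w).map some).reverse ++ o) [] ((w.map some).reverse ++ r) p c)
      (3 * w.length + bs.length + 1) := by
  induction bs with
  | nil =>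
    intro w i o r p c hw
    refine (exec_scan (by decide) (by decide) (by decide) (r := []) (by simp) (w.map some) _
      (by simp) (by simp)).congr ?_ (by simp)
    rw [eq_replicate_false_of_count_true hw, fillMarks_replicate_false]
    simp
  | cons b bs ih =>
    intro w i o r p c hw
    obtain ⟨m, w', rfl, hw'⟩ := exists_eq_replicate_append_cons hw
    have scan_unmarked : Exec (scan word rest out (fun x => x != some true) fun _ => some false)
        (conf i o ((List.replicate m false ++ true :: w').map some) r p c) _ _ :=
      exec_scan (by decide) (by decide) (by decide) (r := some true :: w'.map some)
        (by simp) (List.replicate m (some false)) _ (by simp) (by simp)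
    refine (scan_unmarked.seq <| Exec.pop.seq <| Exec.push.seq <| (Exec.push_of_eq ?_).seq <|
      ih w' i (some b :: (List.replicate m (some false) ++ o))
        (some true :: (List.replicate m (some false) ++ r)) p c hw').congr ?_ ?_
    · simp
    · simp [fillMarks_replicate_append_cons]
    · simp
      omega

/-- Push the letters of a word onto the stack `s`. -/
def pushAll (s : AttachStack) : List (Option Bool) → AttachProg := forEach (push s)

theorem amortizedExec_pushAll_out (l i o w r p c : List (Option Bool)) :
    AmortizedExec out 5 (pushAll out l) (conf i o w r p c) (conf i (l.reverse ++ o) w r p c) 1 := by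
  refine (AmortizedExec.forEach (fun l => conf i (l.reverse ++ o) w r p c)
    (fun l x => (Exec.push_of_eq ?_).amortized (T := 0) ?_) l []).congr (by simp) (by simp)
  · simp
  · simp
    omega

theorem amortizedExec_pushAll_cnt (l i o w r p c : List (Option Bool)) :
    AmortizedExec out 5 (pushAll cnt l) (conf i o w r p c) (conf i o w r p (l.reverse ++ c))
      (l.length + 1) :=
  (AmortizedExec.forEach (fun l => conf i o w r p (l.reverse ++ c))
    (fun l x => (Exec.push_of_eq (by simp)).amortized_of_eq rfl) l []).congr (by simp) (by simp)

/-- Copy the rows of the input to `out` and put an unmarked letter onto `rest` for each row. -/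
def readRows : AttachProg :=
  loop inp (fun _ => true) fun x => match x with
    | none => seq (push out none) (push rest (some false))
    | some b => push out (some b)

theorem exec_readRows (v : List (Option Bool)) : ∀ (o p : List (Option Bool)) (m : ℕ),
    Exec readRows (conf v o [] (List.replicate m (some false)) p [])
      (conf [] (v.reverse ++ o) [] (List.replicate (v.count none + m) (some false)) p [])
      (3 * v.length + 1) := by
  induction v with
  | nil => exact fun o p m => (Exec.loop_exit (by simp)).congr (by simp) (by simp)
  | cons x v ih =>
    intro o p m
    cases x with
    | none =>
      have body : Exec (seq (push out none) (push rest (some false)))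
          (conf v o [] (List.replicate m (some false)) p [])
          (conf v (none :: o) [] (List.replicate (m + 1) (some false)) p []) 2 :=
        Exec.push.seq (Exec.push_of_eq (by simp [List.replicate_succ]))
      exact (Exec.loop_step (s := inp) (a := none) (l := v) rfl rfl (by simpa using body)
        (ih (none :: o) p (m + 1))).congr (by simp [add_assoc, add_comm 1 m]) (by simp; omega)
    | some b =>
      have body : Exec (push out (some b)) (conf v o [] (List.replicate m (some false)) p [])
          (conf v (some b :: o) [] (List.replicate m (some false)) p []) 1 :=
        Exec.push_of_eq (by simp)
      exact (Exec.loop_step (s := inp) (a := some b) (l := v) rfl rfl (by simpa using body)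
        (ih (some b :: o) p m)).congr (by simp) (by simp; omega)

/-- Run `body` for all ways of placing `j` marks on the unmarked letters of `rest`. -/
def forEachMarking (body : AttachProg) : ℕ → AttachProg
  | 0 => seq (move rest word fun _ => true) <| seq body <| move word rest fun x => x == some false
  | j + 1 => seq (loop rest (fun _ => true) fun _ => seq (push word (some true)) <|
      seq (forEachMarking body j) <| seq (pop word) <| push word (some false)) <|
      move word rest fun x => x == some false

end AttachProg

/-- The finite data from which the machine attaches new vertices to a graph. A copy of the fixed
graph is given by a word with `arity` marks and a shape that tells how the fixed graph is placed on
the marked vertices. Each of the `size` new vertices `x` attached to the copy has the list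
`old r x` of adjacencies to the marked vertices, and the adjacencies `new x y` to the other new
vertices. -/
structure GadgetFamily where
  arity : ℕ
  size : ℕ
  Shape : Type
  shapes : List Shape
  old : Shape → Fin size → List Bool
  new : Fin size → Fin size → Bool
  mem_shapes : ∀ r, r ∈ shapes
  nodup_shapes : shapes.Nodup
  length_old : ∀ r x, (old r x).length = arity

namespace GadgetFamily

/-- A group of new vertices: the `copy`-th set of new vertices attached to the copy of the fixed
graph that is given by a word of marks and a shape. -/
@[ext]
structure Group (D : GadgetFamily) where
  word : List Bool
  shape : D.Shape
  copy : ℕ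

variable (D : GadgetFamily)

/-- The row of the new vertex `x` in a group, when there are `c` vertices in previous groups. -/
def rowWord (w : List Bool) (r : D.Shape) (c : ℕ) (x : Fin D.size) : List (Option Bool) :=
  none :: (fillMarks (D.old r x) w ++ List.replicate c false ++
    ((List.finRange D.size).filter (· < x)).map (D.new x)).map some

/-- The rows of the new vertices in a group, when there are `c` vertices in previous groups. -/
def groupWord (c : ℕ) (g : D.Group) : List (Option Bool) :=
  (List.finRange D.size).flatMap (D.rowWord g.word g.shape c)

/-- The rows of the new vertices in the groups of a list. -/
def groupsWord (G : List D.Group) : List (Option Bool) :=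
  G.zipIdx.flatMap fun y => D.groupWord (D.size * y.2) y.1

theorem groupsWord_concat (G : List D.Group) (g : D.Group) :
    D.groupsWord (G ++ [g]) = D.groupsWord G ++ D.groupWord (D.size * G.length) g := by
  simp [groupsWord, List.zipIdx_append]

theorem length_rowWord_le (w : List Bool) (r : D.Shape) (c : ℕ) (x : Fin D.size) :
    (D.rowWord w r c x).length ≤ 1 + w.length + c + D.size := by
  have hfilter := List.length_filter_le (· < x) (List.finRange D.size)
  simp only [List.length_finRange] at hfilter
  simp only [rowWord, List.length_cons, List.length_map, List.length_append, length_fillMarks,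
    List.length_replicate]
  omega

theorem length_groupWord_le (c : ℕ) (g : D.Group) :
    (D.groupWord c g).length ≤ D.size * (1 + g.word.length + c + D.size) := by
  rw [groupWord, List.length_flatMap]
  refine (List.sum_le_card_nsmul _ (1 + g.word.length + c + D.size) ?_).trans (by simp)
  simp only [List.mem_map, forall_exists_index, and_imp]
  rintro _ x - rfl
  exact D.length_rowWord_le _ _ _ _

theorem length_groupsWord_le {n : ℕ} {G : List D.Group} (hG : ∀ g ∈ G, g.word.length = n) :
    (D.groupsWord G).length ≤ G.length * (D.size * (1 + n + D.size * G.length)) := by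
  induction G using List.reverseRecOn with
  | nil => simp [groupsWord]
  | append_singleton G g ih =>
    rw [groupsWord_concat, List.length_append, List.length_append, List.length_singleton]
    have hinit := ih fun g hg => hG g (by simp [hg])
    have hlast := D.length_groupWord_le (D.size * G.length) g
    rw [hG g (by simp)] at hlast
    nlinarith [Nat.zero_le (G.length * (D.size * D.size))]

/-- The groups of new vertices for a copy, in the case of the parameter `k`. -/
def copyGroups (k : ℕ) (w : List Bool) (r : D.Shape) : List D.Group :=
  (List.range (k + 1)).map (.mk w r)

/-- The groups of new vertices for a graph with `n` vertices and the parameter `k`. -/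
def allGroups (k n : ℕ) : List D.Group :=
  (markWords D.arity n).flatMap fun w => D.shapes.flatMap (D.copyGroups k w)

variable {D}

theorem mem_allGroups {k n : ℕ} {g : D.Group} : g ∈ D.allGroups k n ↔
    (g.word.length = n ∧ g.word.count true = D.arity) ∧ g.copy < k + 1 := by
  obtain ⟨w, r, i⟩ := g
  simp [allGroups, copyGroups, mem_markWords, D.mem_shapes]

variable (D)

theorem nodup_allGroups (k n : ℕ) : (D.allGroups k n).Nodup := by
  rw [allGroups, List.nodup_flatMap]
  refine ⟨fun w _ => List.nodup_flatMap.2 ⟨fun r _ => ?_, D.nodup_shapes.imp ?_⟩,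
    (nodup_markWords D.arity n).imp ?_⟩
  · exact List.nodup_range.map fun i j hij => by simpa using hij
  · intro r r' hr g hg hg'
    obtain ⟨i, -, rfl⟩ := List.mem_map.1 hg
    obtain ⟨j, -, hj⟩ := List.mem_map.1 hg'
    exact hr (congrArg Group.shape hj).symm
  · intro w w' hw g hg hg'
    simp only [copyGroups, List.mem_flatMap, List.mem_map] at hg hg'
    obtain ⟨r, -, i, -, rfl⟩ := hg
    obtain ⟨r', -, j, -, hj⟩ := hg'
    exact hw (congrArg Group.word hj).symm

theorem length_allGroups_le (k n : ℕ) :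
    (D.allGroups k n).length ≤ (n + 1) ^ D.arity * (D.shapes.length * (k + 1)) := by
  simp only [allGroups, copyGroups, List.length_flatMap, List.length_map, List.length_range,
    List.map_const', List.sum_replicate, smul_eq_mul]
  exact Nat.mul_le_mul_right _ (length_markWords_le _ _)

end GadgetFamily

namespace AttachProg

/-- Push the word `fillMarks bs w` onto `out`, where `w` is the word on `word`. -/
def writeMarks (bs : List Bool) : AttachProg :=
  seq (emitMarks bs) (move rest word fun _ => true)

/-- Push a letter `some false` onto `out` for each letter on `cnt`. -/
def writeZeros : AttachProg :=
  seq (scan cnt rest out (fun _ => true) fun _ => some false) (move rest cnt fun _ => true)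

theorem exec_writeMarks {bs w : List Bool} (hw : w.count true = bs.length)
    (i o p c : List (Option Bool)) :
    Exec (writeMarks bs) (conf i o (w.map some) [] p c)
      (conf i (((fillMarks bs w).map some).reverse ++ o) (w.map some) [] p c)
      (5 * w.length + bs.length + 2) :=
  ((exec_emitMarks bs w i o [] p c hw).seq <|
    exec_move (by decide) (r := []) (by simp) (w.map some).reverse _ (by simp) (by simp)).congr
    (by simp) (by simp; omega)

theorem exec_writeZeros (i o w p : List (Option Bool)) (m : ℕ) :
    Exec writeZeros (conf i o w [] p (List.replicate m none))
      (conf i (List.replicate m (some false) ++ o) w [] p (List.replicate m none))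
      (5 * m + 2) :=
  ((exec_scan (by decide) (by decide) (by decide) (r := []) (by simp) (List.replicate m none) _
    (by simp) (by simp)).seq <|
    exec_move (by decide) (r := []) (by simp) (List.replicate m none) _ (by simp) (by simp)).congr
    (by simp) (by simp; omega)

end AttachProg

namespace GadgetFamily

variable (D : GadgetFamily)

/-- Write the row of the new vertex `x` onto `out`, when `word` holds the word of marks and `cnt`
the number of vertices in previous groups. -/
def rowProg (r : D.Shape) (x : Fin D.size) : AttachProg :=
  seq (push out none) <| seq (AttachProg.writeMarks (D.old r x)) <| seq AttachProg.writeZeros <|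
    AttachProg.pushAll out ((((List.finRange D.size).filter (· < x)).map (D.new x)).map some)

theorem amortizedExec_rowProg (r : D.Shape) (x : Fin D.size) {w : List Bool}
    (hw : w.count true = D.arity) (i o p : List (Option Bool)) (c : ℕ) :
    AmortizedExec out 5 (D.rowProg r x) (conf i o (w.map some) [] p (List.replicate c none))
      (conf i ((D.rowWord w r c x).reverse ++ o) (w.map some) [] p (List.replicate c none))
      (D.arity + 1) := by
  have push_none : Exec (push out none) (conf i o (w.map some) [] p (List.replicate c none))
      (conf i (none :: o) (w.map some) [] p (List.replicate c none)) 1 :=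
    Exec.push_of_eq (by simp)
  have write_marks := AttachProg.exec_writeMarks (hw.trans (D.length_old r x).symm) i (none :: o) p
    (List.replicate c none)
  have write_zeros := AttachProg.exec_writeZeros i
    (((fillMarks (D.old r x) w).map some).reverse ++ none :: o) (w.map some) p c
  obtain ⟨t, write_new, ht⟩ := AttachProg.amortizedExec_pushAll_out
    ((((List.finRange D.size).filter (· < x)).map (D.new x)).map some) i
    (List.replicate c (some false) ++ (((fillMarks (D.old r x) w).map some).reverse ++ none :: o))
    (w.map some) [] p (List.replicate c none)
  refine ⟨_, (push_none.seq <| write_marks.seq <| write_zeros.seq write_new).congr ?_ le_rfl, ?_⟩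
  · simp [rowWord]
  · simp only [conf_out, rowWord, List.length_append, List.length_reverse, List.length_cons,
      List.length_map, length_fillMarks, List.length_replicate, D.length_old] at ht ⊢
    omega

/-- Write the rows of the new vertices of a group onto `out` and count these vertices on `cnt`. -/
def groupProg (r : D.Shape) : AttachProg :=
  seq (forEach (D.rowProg r) (List.finRange D.size)) <|
    AttachProg.pushAll cnt (List.replicate D.size none)

/-- The number `k` in unary. -/
def unary (k : ℕ) : List (Option Bool) := List.replicate k (some true)

/-- The configuration in which the rows of the groups `G` have been appended to the word `u`. -/
def state (u : List (Option Bool)) (G : List D.Group) (w : List Bool) (m k j : ℕ) :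
    AttachStack → List (Option Bool) :=
  conf (unary j) (u ++ D.groupsWord G).reverse (w.map some) (List.replicate m (some false))
    (unary k) (List.replicate (D.size * G.length) none)

section Copies

variable {D} {w : List Bool}

theorem amortizedExec_groupProg (hw : w.count true = D.arity) (r : D.Shape)
    (u : List (Option Bool)) (G : List D.Group) (i k j : ℕ) :
    AmortizedExec out 5 (D.groupProg r) (D.state u G w 0 k j) (D.state u (G ++ [⟨w, r, i⟩]) w 0 k j)
      (D.size * (D.arity + 2) + 2) := by
  have rows := AmortizedExec.forEach
    (fun l => conf (unary j)
      ((u ++ D.groupsWord G ++ l.flatMap (D.rowWord w r (D.size * G.length))).reverse)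
      (w.map some) [] (unary k) (List.replicate (D.size * G.length) none))
    (fun l x => (D.amortizedExec_rowProg r x hw _ _ _ _).congr (by simp) le_rfl)
    (List.finRange D.size) []
  simp only [List.flatMap_nil, List.append_nil, List.nil_append] at rows
  refine (rows.seq <|
    AttachProg.amortizedExec_pushAll_cnt (List.replicate D.size none) _ _ _ _ _ _).congr ?_ ?_
  · simp [state, groupsWord_concat, groupWord, mul_add, add_comm]
  · simp only [List.length_finRange, List.length_replicate]
    linarith

variable (D)

/-- Attach the groups `⟨w, r, 0⟩, …, ⟨w, r, k⟩`, where `w` is the word on `word` and `k` is the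
parameter on `par`. -/
def copiesProg (r : D.Shape) : AttachProg :=
  seq (D.groupProg r) <|
    seq (loop par (fun _ => true) fun x => seq (push inp x) (D.groupProg r)) <|
    move inp par fun _ => true

variable {D}

theorem amortizedExec_copiesLoop (hw : w.count true = D.arity) (r : D.Shape)
    (u : List (Option Bool)) (k : ℕ) : ∀ (G : List D.Group) (j : ℕ),
    AmortizedExec out 5 (loop par (fun _ => true) fun x => seq (push inp x) (D.groupProg r))
      (D.state u G w 0 k j)
      (D.state u (G ++ (List.range' (j + 1) k).map (.mk w r)) w 0 0 (j + k))
      (k * (D.size * (D.arity + 2) + 4) + 1) := by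
  induction k with
  | zero =>
    exact fun G j => ((Exec.loop_exit (by simp [state, unary])).amortized_of_eq rfl).congr
      (by simp) (by simp)
  | succ k ih =>
    intro G j
    have push_par : Exec (push inp (some true)) (D.state u G w 0 k j) (D.state u G w 0 k (j + 1))
        1 := Exec.push_of_eq (by simp [state, unary, List.replicate_succ])
    have body := (push_par.amortized_of_eq rfl).seq
      (amortizedExec_groupProg hw r u G (j + 1) k (j + 1))
    refine (AmortizedExec.loop_step (by decide) (a := some true) (l := unary k)
      (by simp [state, unary, List.replicate_succ]) rfl
      (T := 1 + (D.size * (D.arity + 2) + 2)) (by simpa [state] using body)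
      (ih (G ++ [⟨w, r, j + 1⟩]) (j + 1))).congr ?_ (by linarith)
    rw [List.range'_succ]
    simp [add_assoc, add_comm 1 k]

theorem amortizedExec_copiesProg (hw : w.count true = D.arity) (u : List (Option Bool)) (k : ℕ)
    (G : List D.Group) (r : D.Shape) :
    AmortizedExec out 5 (D.copiesProg r) (D.state u G w 0 k 0)
      (D.state u (G ++ D.copyGroups k w r) w 0 k 0) ((k + 1) * (D.size * (D.arity + 2) + 6)) := by
  have restore_par (G : List D.Group) : Exec (move inp par fun _ => true)
      (D.state u G w 0 0 (0 + k)) (D.state u G w 0 k 0) (2 * k + 1) :=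
    (exec_move (by decide) (r := []) (by simp) (unary k) _ (by simp [state])
      (by simp)).congr (by simp [state, unary]) (by simp [unary])
  refine ((amortizedExec_groupProg hw r u G 0 k 0).seq <|
    (amortizedExec_copiesLoop hw r u k _ 0).seq <|
    (restore_par _).amortized_of_eq rfl).congr ?_ (by linarith)
  simp [copyGroups, List.range_eq_range', List.range'_succ]

theorem amortizedExec_forEach_copiesProg (hw : w.count true = D.arity) (u : List (Option Bool))
    (k : ℕ) (G : List D.Group) :
    AmortizedExec out 5 (forEach D.copiesProg D.shapes) (D.state u G w 0 k 0)
      (D.state u (G ++ D.shapes.flatMap (D.copyGroups k w)) w 0 k 0)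
      (D.shapes.length * ((k + 1) * (D.size * (D.arity + 2) + 6)) + 1) := by
  simpa only [List.flatMap_nil, List.append_nil, List.nil_append] using AmortizedExec.forEach
    (fun l => D.state u (G ++ l.flatMap (D.copyGroups k w)) w 0 k 0)
    (fun l r => (amortizedExec_copiesProg hw u k _ r).congr (by simp) le_rfl) D.shapes []

end Copies

section ForEachMarking

variable {D} {w : List Bool} {n T : ℕ} {u : List (Option Bool)} {k : ℕ} {body : AttachProg}
  {f : List Bool → List D.Group}

theorem exec_restoreWord (hw : ∀ b ∈ w.head?, b = true) (G : List D.Group) (m : ℕ) :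
    Exec (move word rest fun x => x == some false) (D.state u G (List.replicate m false ++ w) 0 k 0)
      (D.state u G w m k 0) (2 * m + 1) := by
  refine (exec_move (by decide) (r := w.map some) ?_ (List.replicate m (some false)) _
    (by simp [state]) (by simp)).congr (by simp [state]) (by simp)
  cases w <;> simp_all

theorem amortizedExec_forEachMarking_zero
    (hbody : ∀ w G, w.length = n → w.count true = D.arity → AmortizedExec out 5 body
      (D.state u G w 0 k 0) (D.state u (G ++ f w) w 0 k 0) T)
    {m : ℕ} (G : List D.Group) (hw : ∀ b ∈ w.head?, b = true) (hlen : w.length + m = n)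
    (hcount : w.count true = D.arity) :
    AmortizedExec out 5 (AttachProg.forEachMarking body 0) (D.state u G w m k 0)
      (D.state u (G ++ f (List.replicate m false ++ w)) w m k 0) (T + 6 * n + 2) := by
  have fill : Exec (move rest word fun _ => true) (D.state u G w m k 0)
      (D.state u G (List.replicate m false ++ w) 0 k 0) (2 * m + 1) :=
    (exec_move (by decide) (r := []) (by simp) (List.replicate m (some false)) _
      (by simp [state]) (by simp)).congr (by simp [state]) (by simp)
  refine ((fill.amortized_of_eq rfl).seq <|
    (hbody (List.replicate m false ++ w) G (by simp; omega)
      (by simpa [List.count_replicate] using hcount)).seq <|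
    (exec_restoreWord hw _ m).amortized_of_eq rfl).congr rfl (by omega)

theorem amortizedExec_markingLoop {j : ℕ}
    (hbody : ∀ (m : ℕ) (w : List Bool) (G : List D.Group), (∀ b ∈ w.head?, b = true) →
      w.length + m = n → w.count true + j = D.arity →
      AmortizedExec out 5 body (D.state u G w m k 0)
        (D.state u (G ++ (markWords j m).flatMap fun e => f (e ++ w)) w m k 0) T)
    (m : ℕ) : ∀ (w : List Bool) (G : List D.Group), w.length + m = n →
      w.count true + (j + 1) = D.arity →
      AmortizedExec out 5
        (loop rest (fun _ => true) fun _ => seq (push word (some true)) <| seq body <|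
          seq (pop word) <| push word (some false))
        (D.state u G w m k 0)
        (D.state u (G ++ (markWords (j + 1) m).flatMap fun e => f (e ++ w))
          (List.replicate m false ++ w) 0 k 0) (m * (T + 4) + 1) := by
  induction m with
  | zero =>
    exact fun w G _ _ => ((Exec.loop_exit (by simp [state])).amortized_of_eq rfl).congr
      (by simp [markWords]) (by simp)
  | succ m ih =>
    intro w G hlen hcount
    have mark : Exec (push word (some true)) (D.state u G w m k 0)
        (D.state u G (true :: w) m k 0) 1 := Exec.push_of_eq (by simp [state])
    have unmark (G : List D.Group) : Exec (seq (pop word) (push word (some false)))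
        (D.state u G (true :: w) m k 0) (D.state u G (false :: w) m k 0) 2 :=
      Exec.pop.seq (Exec.push_of_eq (by simp [state]))
    have marked := hbody m (true :: w) G (by simp) (by simp; omega) (by simp; omega)
    have step := (mark.amortized_of_eq rfl).seq (marked.seq ((unmark _).amortized_of_eq rfl))
    have unmarked := ih (false :: w) (G ++ (markWords j m).flatMap fun e => f (e ++ true :: w))
      (by simp; omega) (by simpa using hcount)
    refine (AmortizedExec.loop_step (T := 1 + (T + 2)) (by decide) (a := some false)
      (l := List.replicate m (some false)) (by simp [state, List.replicate_succ]) rfl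
      (by simpa [state] using step) unmarked).congr ?_ (by linarith)
    congr 1
    · simp [markWords, List.flatMap_append, List.flatMap_map]
    · simp [List.replicate_succ']

theorem amortizedExec_forEachMarking
    (hbody : ∀ w G, w.length = n → w.count true = D.arity → AmortizedExec out 5 body
      (D.state u G w 0 k 0) (D.state u (G ++ f w) w 0 k 0) T) (j : ℕ) :
    ∀ (m : ℕ) (w : List Bool) (G : List D.Group), (∀ b ∈ w.head?, b = true) →
      w.length + m = n → w.count true + j = D.arity →
      AmortizedExec out 5 (AttachProg.forEachMarking body j) (D.state u G w m k 0)
        (D.state u (G ++ (markWords j m).flatMap fun e => f (e ++ w)) w m k 0)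
        ((n + 1) ^ j * (T + 6 * n + 2)) := by
  induction j with
  | zero =>
    exact fun m w G hw hlen hcount =>
      (amortizedExec_forEachMarking_zero hbody G hw hlen hcount).congr (by simp [markWords])
        (by simp)
  | succ j ih =>
    intro m w G hw hlen hcount
    refine ((amortizedExec_markingLoop ih m w G hlen hcount).seq
      ((exec_restoreWord hw _ m).amortized_of_eq rfl)).congr rfl ?_
    set X := (n + 1) ^ j * (T + 6 * n + 2)
    have hX : 6 * n + 2 ≤ X :=
      (by omega : 6 * n + 2 ≤ T + 6 * n + 2).trans (Nat.le_mul_of_pos_left _ (by positivity))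
    calc m * (X + 4) + 1 + (2 * m + 1)
        ≤ n * (X + 4) + 1 + (2 * n + 1) := by gcongr <;> omega
      _ ≤ n * X + X := by linarith
      _ = (n + 1) ^ (j + 1) * (T + 6 * n + 2) := by simp only [X]; ring

end ForEachMarking

/-- Append the rows of the groups of new vertices to the encoding of an instance. -/
def mainProg : AttachProg :=
  seq (scan inp par out (fun x => x == some true) id) <| seq AttachProg.readRows <|
    seq (AttachProg.forEachMarking (forEach D.copiesProg D.shapes) D.arity) <|
    seq (clear par) <| seq (clear rest) <| seq (clear cnt) <| move out inp fun _ => true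

variable {D}

theorem exec_readParam {k : ℕ} {v : List (Option Bool)} (hv : v.head? ≠ some (some true)) :
    Exec (scan inp par out (fun x => x == some true) id) (conf (unary k ++ v) [] [] [] [] [])
      (conf v (unary k) [] [] (unary k) []) (3 * k + 1) := by
  refine (exec_scan (by decide) (by decide) (by decide) (r := v) ?_ (unary k)
    (conf (unary k ++ v) [] [] [] [] []) rfl (by simp [unary])).congr (by simp [unary])
    (by simp [unary])
  intro x hx
  simp only [beq_eq_false_iff_ne]
  rintro rfl
  exact hv hx

theorem amortizedExec_attachGroups (u : List (Option Bool)) (k n : ℕ) :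
    AmortizedExec out 5 (AttachProg.forEachMarking (forEach D.copiesProg D.shapes) D.arity)
      (D.state u [] [] n k 0) (D.state u (D.allGroups k n) [] n k 0)
      ((n + 1) ^ D.arity *
        (D.shapes.length * ((k + 1) * (D.size * (D.arity + 2) + 6)) + 1 + 6 * n + 2)) := by
  simpa only [allGroups, List.append_nil, List.nil_append] using
    amortizedExec_forEachMarking (f := fun w => D.shapes.flatMap (D.copyGroups k w))
      (fun w G _ hw => amortizedExec_forEach_copiesProg hw u k G) D.arity n [] [] (by simp)
      (by simp) (by simp)

theorem exec_returnOutput (u : List (Option Bool)) (G : List D.Group) (n k : ℕ) :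
    Exec (seq (clear par) <| seq (clear rest) <| seq (clear cnt) <| move out inp fun _ => true)
      (D.state u G [] n k 0) (conf (u ++ D.groupsWord G) [] [] [] [] [])
      (2 * k + 2 * n + 2 * (D.size * G.length) + 2 * (u.length + (D.groupsWord G).length) + 4) :=
  ((exec_clear _ _).seq <| (exec_clear _ _).seq <| (exec_clear _ _).seq <|
    exec_move (by decide) (r := []) (by simp) _ _ (List.append_nil _).symm (by simp)).congr
    (by simp [state, unary]) (by simp [state, unary]; omega)

theorem exec_mainProg (k : ℕ) {v : List (Option Bool)} (hv : v.head? ≠ some (some true)) {n : ℕ}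
    (hn : v.count none = n) :
    Exec D.mainProg (conf (unary k ++ v) [] [] [] [] [])
      (conf (unary k ++ v ++ D.groupsWord (D.allGroups k n)) [] [] [] [] [])
      (7 * k + 5 * v.length + 2 * n + 2 * (D.size * (D.allGroups k n).length) +
        7 * (D.groupsWord (D.allGroups k n)).length + 6 + (n + 1) ^ D.arity *
        (D.shapes.length * ((k + 1) * (D.size * (D.arity + 2) + 6)) + 1 + 6 * n + 2)) := by
  have read_rows : Exec AttachProg.readRows (conf v (unary k) [] [] (unary k) [])
      (D.state (unary k ++ v) [] [] n k 0) (3 * v.length + 1) :=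
    (AttachProg.exec_readRows v (unary k) (unary k) 0).congr
      (by simp [state, groupsWord, unary, hn]) le_rfl
  obtain ⟨t, attach, ht⟩ := amortizedExec_attachGroups (D := D) (unary k ++ v) k n
  refine ((exec_readParam hv).seq <| read_rows.seq <| attach.seq <|
    exec_returnOutput _ _ _ _).congr rfl ?_
  simp only [state, conf_out, List.length_reverse, List.length_append, groupsWord,
    List.zipIdx_nil, List.flatMap_nil, List.length_nil, unary, List.length_replicate] at ht ⊢
  omega

section PolyTime

open Polynomial

variable (D)

/-- A bound on the number of groups in terms of the length of the encoded instance. -/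
noncomputable def groupBound : ℕ[X] := (X + 1) ^ D.arity * ((D.shapes.length : ℕ[X]) * (X + 1))

/-- A bound on the length of the rows of all groups in terms of the length of the encoded
instance. -/
noncomputable def rowsBound : ℕ[X] :=
  D.groupBound * ((D.size : ℕ[X]) * (1 + X + (D.size : ℕ[X]) * D.groupBound))

/-- A bound on the running time of the machine for `mainProg` in terms of the length of the encoded
instance. -/
noncomputable def timeBound : ℕ[X] :=
  7 * X + 2 * ((D.size : ℕ[X]) * D.groupBound) + 7 * D.rowsBound + 6 + (X + 1) ^ D.arity *
    ((D.shapes.length : ℕ[X]) * ((X + 1) * ((D.size : ℕ[X]) * ((D.arity : ℕ[X]) + 2) + 6)) + 1 +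
      6 * X + 2) + 1

variable {k n N : ℕ}

theorem length_allGroups_le_eval (hk : k ≤ N) (hn : n ≤ N) :
    (D.allGroups k n).length ≤ D.groupBound.eval N := by
  refine (D.length_allGroups_le k n).trans ?_
  simp only [groupBound, eval_mul, eval_pow, eval_add, eval_X, eval_one, eval_natCast, Nat.cast_id]
  gcongr

theorem length_groupsWord_le_eval (hk : k ≤ N) (hn : n ≤ N) :
    (D.groupsWord (D.allGroups k n)).length ≤ D.rowsBound.eval N := by
  refine (D.length_groupsWord_le fun g hg => (mem_allGroups.1 hg).1.1).trans ?_
  have hgroups := D.length_allGroups_le_eval hk hn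
  simp only [rowsBound, eval_mul, eval_add, eval_X, eval_one, eval_natCast, Nat.cast_id]
  gcongr

variable {D}

theorem exists_encode_eq (I : ParamGraph) : ∃ v : List (Option Bool),
    I.encode = unary I.k ++ v ∧ v.head? ≠ some (some true) ∧ v.count none = I.n := by
  refine ⟨_, rfl, ?_, ?_⟩
  · cases List.finRange I.n <;> simp
  · rw [List.count_flatMap]
    calc _ = ((List.finRange I.n).map fun _ => 1).sum := by
          congr 2
          funext v
          simp [List.count_eq_zero]
      _ = I.n := by simp

theorem outputsInTime_mainProg {I J : ParamGraph}
    (h : J.encode = I.encode ++ D.groupsWord (D.allGroups I.k I.n)) :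
    Nonempty (Turing.TM2OutputsInTime (D.mainProg.toFinTM2 inp) I.encode (some J.encode)
      (D.timeBound.eval I.encode.length)) := by
  obtain ⟨v, hI, hv, hn⟩ := exists_encode_eq I
  have hexec := exec_mainProg (D := D) I.k hv hn
  rw [← hI, ← h, ← update_nil_inp, ← update_nil_inp] at hexec
  obtain ⟨run⟩ := outputsInTime_toFinTM2 hexec
  refine ⟨⟨run.toEvalsTo, run.steps_le_m.trans ?_⟩⟩
  have hlen : I.encode.length = I.k + v.length := by simp [hI, unary]
  have hn_le_v : I.n ≤ v.length := hn ▸ List.count_le_length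
  have hk : I.k ≤ I.encode.length := by omega
  have hn_le : I.n ≤ I.encode.length := by omega
  have hgroups := D.length_allGroups_le_eval hk hn_le
  have hrows := D.length_groupsWord_le_eval hk hn_le
  have hlinear : 7 * I.k + 5 * v.length + 2 * I.n ≤ 7 * I.encode.length := by omega
  simp only [timeBound, eval_mul, eval_pow, eval_add, eval_X, eval_one, eval_natCast, eval_ofNat,
    Nat.cast_id]
  gcongr

theorem nonempty_computableInPolyTime {f : ParamGraph → ParamGraph}
    (hf : ∀ I, (f I).encode = I.encode ++ D.groupsWord (D.allGroups I.k I.n)) :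
    Nonempty (Turing.TM2ComputableInPolyTime ParamGraph.encode ParamGraph.encode f) :=
  ⟨{ tm := D.mainProg.toFinTM2 inp
     inputAlphabet := Equiv.refl _
     outputAlphabet := Equiv.refl _
     time := D.timeBound
     outputsFun := fun I => by
      have run := (outputsInTime_mainProg (hf I)).some
      rw [← List.map_id I.encode, ← List.map_id (f I).encode, List.length_map] at run
      exact run }⟩

end PolyTime

end GadgetFamily

/-! ### Copies in a complete graph and words of marks -/

theorem count_take_lt_count_take {w : List Bool} {u v : ℕ} (hu : u < w.length) (hwu : w[u] = true)
    (huv : u < v) : (w.take u).count true < (w.take v).count true := by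
  have hsucc : (w.take (u + 1)).count true = (w.take u).count true + 1 := by
    simp [List.take_succ_eq_append_getElem hu, hwu]
  have hle := (List.take_sublist_take_left (l := w) (show u + 1 ≤ v from huv)).count_le true
  omega

theorem exists_count_take_eq {w : List Bool} {j : ℕ} (hj : j < w.count true) :
    ∃ (u : ℕ) (hu : u < w.length), w[u] = true ∧ (w.take u).count true = j := by
  induction w generalizing j with
  | nil => simp at hj
  | cons c w ih =>
    match c, j with
    | false, j =>
      obtain ⟨u, hu, hwu, hcount⟩ := ih (j := j) (by simpa using hj)
      exact ⟨u + 1, by simpa using hu, by simpa using hwu, by simpa using hcount⟩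
    | true, 0 => exact ⟨0, by simp, by simp, by simp⟩
    | true, j + 1 =>
      obtain ⟨u, hu, hwu, hcount⟩ := ih (j := j) (by simpa using hj)
      exact ⟨u + 1, by simpa using hu, by simpa using hwu, by simpa using hcount⟩

/-- The words of length `n` with `h` marks. -/
abbrev MarkWord (n h : ℕ) := {w : List Bool // w.length = n ∧ w.count true = h}

namespace MarkWord

variable {n h : ℕ} (w : MarkWord n h)

/-- The set of vertices that a word marks. -/
def marked : Set (Fin n) := {u | w.1[u.1]'(w.2.1.symm ▸ u.2) = true}

theorem marked_injective : Function.Injective (marked : MarkWord n h → Set (Fin n)) := by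
  intro w w' hw
  refine Subtype.ext (List.ext_getElem (w.2.1.trans w'.2.1.symm) fun u hu hu' => ?_)
  exact Bool.eq_iff_iff.2 (Set.ext_iff.1 hw ⟨u, w.2.1 ▸ hu⟩)

theorem strictMonoOn_count_take :
    StrictMonoOn (fun u : Fin n => (w.1.take u).count true) w.marked :=
  fun _ hu _ _ huv => count_take_lt_count_take _ hu huv

theorem count_take_lt {u : Fin n} (hu : u ∈ w.marked) : (w.1.take u).count true < h := by
  have hlt := count_take_lt_count_take _ hu (w.2.1.symm ▸ u.2 : u.1 < w.1.length)
  rwa [List.take_length, w.2.2] at hlt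

/-- The marked vertices of a word, numbered from left to right. -/
noncomputable def equiv : w.marked ≃ Fin h :=
  Equiv.ofBijective (fun u => ⟨(w.1.take u).count true, w.count_take_lt u.2⟩) <| by
    refine ⟨fun u v huv => ?_, fun j => ?_⟩
    · exact Subtype.ext (w.strictMonoOn_count_take.injOn u.2 v.2 (Fin.ext_iff.1 huv))
    · obtain ⟨u, hu, hwu, hcount⟩ := exists_count_take_eq (w.2.2.symm ▸ j.2 : j.1 < w.1.count true)
      exact ⟨⟨⟨u, w.2.1 ▸ hu⟩, hwu⟩, Fin.ext hcount⟩

theorem exists_marked_eq {T : Set (Fin n)} (hT : Nat.card T = h) :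
    ∃ w : MarkWord n h, w.marked = T := by
  classical
  let l : List Bool := List.ofFn fun u => decide (u ∈ T)
  let w : MarkWord n (l.count true) := ⟨l, List.length_ofFn, rfl⟩
  have hw : w.marked = T := by
    ext u
    simp [marked, w, l]
  obtain rfl : l.count true = h := by
    rw [← hT, ← hw, Nat.card_congr w.equiv, Nat.card_fin]
  exact ⟨w, hw⟩

end MarkWord

theorem copy_toSubgraph_eq_iff {V W : Type*} {A : SimpleGraph V} {B : SimpleGraph W} (g : A.Copy B)
    (C : B.Subgraph) :
    g.toSubgraph = C ↔ Set.range g = C.verts ∧ ∀ a b, C.Adj (g a) (g b) ↔ A.Adj a b := by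
  constructor
  · rintro rfl
    refine ⟨by simp, fun a b => ⟨?_, fun hab => ⟨a, b, hab, rfl, rfl⟩⟩⟩
    rintro ⟨a', b', hab, ha, hb⟩
    rwa [← g.injective ha, ← g.injective hb]
  · rintro ⟨hrange, hadj⟩
    ext u v
    · simp [← hrange]
    · constructor
      · rintro ⟨a, b, hab, rfl, rfl⟩
        exact (hadj a b).2 hab
      · intro huv
        obtain ⟨a, rfl⟩ : u ∈ Set.range g := hrange ▸ C.edge_vert huv
        obtain ⟨b, rfl⟩ : v ∈ Set.range g := hrange ▸ C.edge_vert huv.symm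
        exact ⟨a, b, (hadj a b).1 huv, rfl, rfl⟩

/-- The graphs on `Fin h` that are isomorphic to `A`. -/
abbrev IsoGraph {V : Type*} (A : SimpleGraph V) (h : ℕ) :=
  {K : SimpleGraph (Fin h) // Nonempty (A ≃g K)}

section markedCopy

variable {V : Type*} {A : SimpleGraph V} {n h : ℕ} (w : MarkWord n h) (K : IsoGraph A h)

/-- The copy of `A` on the marked vertices of a word that a graph on `Fin h` describes. -/
noncomputable def markedCopy : A.Copy (⊤ : SimpleGraph (Fin n)) where
  toHom := ⟨fun v => (w.equiv.symm (K.2.some v)).1, fun {a b} hab => by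
    rw [SimpleGraph.top_adj, Ne, Subtype.val_inj, w.equiv.symm.injective.eq_iff,
      K.2.some.injective.eq_iff]
    exact hab.ne⟩
  injective' := Subtype.val_injective.comp (w.equiv.symm.injective.comp K.2.some.injective)

theorem markedCopy_apply (v : V) : markedCopy w K v = (w.equiv.symm (K.2.some v)).1 := rfl

theorem exists_markedCopy_eq_and_iff {p : V → Prop} {u : Fin n} :
    (∃ v, markedCopy w K v = u ∧ p v) ↔
      ∃ hu : u ∈ w.marked, p (K.2.some.symm (w.equiv ⟨u, hu⟩)) := by
  constructor
  · rintro ⟨v, rfl, hv⟩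
    refine ⟨(w.equiv.symm (K.2.some v)).2, ?_⟩
    change p (K.2.some.symm (w.equiv (w.equiv.symm (K.2.some v))))
    rwa [Equiv.apply_symm_apply, RelIso.symm_apply_apply]
  · rintro ⟨hu, hp⟩
    exact ⟨_, by simp [markedCopy_apply], hp⟩

theorem range_markedCopy : Set.range (markedCopy w K) = w.marked := by
  ext u
  simpa using exists_markedCopy_eq_and_iff w K (p := fun _ => True)

/-- The copy of `A` in the complete graph that a word of marks and a graph on `Fin h` describe. -/
noncomputable def markedSubgraph (y : MarkWord n h × IsoGraph A h) : CopyInComplete A (Fin n) :=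
  ⟨(markedCopy y.1 y.2).toSubgraph, ⟨(markedCopy y.1 y.2).isoToSubgraph⟩⟩

variable {w K}

theorem adj_iff_of_toSubgraph_markedCopy_eq {C : (⊤ : SimpleGraph (Fin n)).Subgraph}
    (hC : (markedCopy w K).toSubgraph = C) (i j : Fin h) :
    K.1.Adj i j ↔ C.Adj (w.equiv.symm i).1 (w.equiv.symm j).1 := by
  have hadj := ((copy_toSubgraph_eq_iff _ C).1 hC).2 (K.2.some.symm i) (K.2.some.symm j)
  simp only [markedCopy_apply, RelIso.apply_symm_apply] at hadj
  exact K.2.some.symm.map_adj_iff.symm.trans hadj.symm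

theorem markedSubgraph_injective : Function.Injective
    (markedSubgraph : MarkWord n h × IsoGraph A h → CopyInComplete A (Fin n)) := by
  rintro ⟨w, K⟩ ⟨w', K'⟩ hy
  have hsub : (markedCopy w K).toSubgraph = (markedCopy w' K').toSubgraph :=
    congrArg Subtype.val hy
  obtain rfl : w = w' := MarkWord.marked_injective <| by
    rw [← range_markedCopy w K, ← range_markedCopy w' K',
      ((copy_toSubgraph_eq_iff _ _).1 hsub).1, ((copy_toSubgraph_eq_iff _ _).1 rfl).1]
  obtain rfl : K = K' := by
    ext i j
    rw [adj_iff_of_toSubgraph_markedCopy_eq hsub, adj_iff_of_toSubgraph_markedCopy_eq rfl]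
  rfl

theorem markedSubgraph_surjective (hV : Nat.card V = h) : Function.Surjective
    (markedSubgraph : MarkWord n h × IsoGraph A h → CopyInComplete A (Fin n)) := by
  rintro ⟨C, ⟨ψ⟩⟩
  obtain ⟨w, hw⟩ := MarkWord.exists_marked_eq ((Nat.card_congr ψ.toEquiv.symm).trans hV)
  let ε : Fin h ≃ C.verts := w.equiv.symm.trans (Equiv.setCongr hw)
  let K : IsoGraph A h := ⟨C.coe.comap ε, ⟨ψ.trans (SimpleGraph.Iso.comap ε C.coe).symm⟩⟩
  refine ⟨(w, K), Subtype.ext ((copy_toSubgraph_eq_iff _ _).2 ⟨?_, fun a b => ?_⟩)⟩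
  · rw [range_markedCopy, hw]
  · exact K.2.some.map_adj_iff

end markedCopy

/-! ### The encoding of the graph with attached copies -/

section flatMapBefore

variable {α β γ : Type*}

/-- The concatenation of the lists `F x p`, where `x` runs through a list and `p` consists of the
elements before `x`, after the elements of an initial list. -/
def flatMapBefore (F : α → List α → List β) : List α → List α → List β
  | _, [] => []
  | p, x :: l => F x p ++ flatMapBefore F (p ++ [x]) l

theorem flatMapBefore_append (F : α → List α → List β) (p l l' : List α) :
    flatMapBefore F p (l ++ l') = flatMapBefore F p l ++ flatMapBefore F (p ++ l) l' := by
  induction l generalizing p with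
  | nil => simp [flatMapBefore]
  | cons x l ih => simp [flatMapBefore, ih]

theorem flatMapBefore_map {F : α → List α → List β} {F' : γ → List γ → List β} {f : γ → α}
    {p : List α} (hF : ∀ x q, F (f x) (p ++ q.map f) = F' x q) (q l : List γ) :
    flatMapBefore F (p ++ q.map f) (l.map f) = flatMapBefore F' q l := by
  induction l generalizing q with
  | nil => rfl
  | cons x l ih => simp [flatMapBefore, hF, ← ih]

theorem flatMapBefore_map_nil {F : α → List α → List β} {F' : γ → List γ → List β} {f : γ → α}
    {p : List α} (hF : ∀ x q, F (f x) (p ++ q.map f) = F' x q) (l : List γ) :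
    flatMapBefore F p (l.map f) = flatMapBefore F' [] l := by
  simpa using flatMapBefore_map hF [] l

theorem filter_lt_finRange {n : ℕ} {x : Fin n} {ys zs : List (Fin n)}
    (h : ys ++ x :: zs = List.finRange n) : (List.finRange n).filter (· < x) = ys := by
  have hsorted := List.pairwise_lt_finRange n
  rw [← h, List.pairwise_append] at hsorted
  obtain ⟨-, hzs, hys⟩ := hsorted
  rw [← h, List.filter_append, List.filter_eq_self.2, List.filter_eq_nil_iff.2, List.append_nil]
  · simpa using fun z hz => (List.rel_of_pairwise_cons hzs hz).le
  · simpa using fun y hy => hys y hy x List.mem_cons_self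

theorem flatMap_filter_lt_finRange {n : ℕ} (F : Fin n → List (Fin n) → List β) :
    (List.finRange n).flatMap (fun v => F v ((List.finRange n).filter (· < v))) =
      flatMapBefore F [] (List.finRange n) := by
  suffices hsplit : ∀ zs ys : List (Fin n), ys ++ zs = List.finRange n →
      zs.flatMap (fun v => F v ((List.finRange n).filter (· < v))) = flatMapBefore F ys zs from
    hsplit _ [] rfl
  intro zs
  induction zs with
  | nil => exact fun _ _ => rfl
  | cons x zs ih =>
    intro ys h
    rw [List.flatMap_cons, flatMapBefore, filter_lt_finRange h, ih (ys ++ [x]) (by simpa using h)]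

end flatMapBefore

section adjRow

open Classical in
/-- The row of a vertex `v` in an encoding of `G` that lists the vertices of `p` before `v`. -/
noncomputable def adjRow {W : Type*} (G : SimpleGraph W) (v : W) (p : List W) :
    List (Option Bool) :=
  none :: p.map fun u => some (decide (G.Adj v u))

theorem adjRow_embedding {W W' : Type*} {G : SimpleGraph W} {G' : SimpleGraph W'} (j : G ↪g G')
    (v : W) (p : List W) : adjRow G' (j v) (p.map j) = adjRow G v p := by
  simp [adjRow, Function.comp_def, j.map_adj_iff]

theorem ParamGraph.encode_eq (I : ParamGraph) :
    I.encode = List.replicate I.k (some true) ++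
      flatMapBefore (adjRow I.graph) [] (List.finRange I.n) := by
  rw [← flatMap_filter_lt_finRange]
  rfl

theorem ParamGraph.exists_encode_eq_flatMapBefore {W : Type*} (A : SimpleGraph W) (k : ℕ)
    {L : List W} (hL : L.Nodup) (hmem : ∀ v, v ∈ L) :
    ∃ J : ParamGraph, J.k = k ∧ Nonempty (J.graph ≃g A) ∧
      J.encode = List.replicate k (some true) ++ flatMapBefore (adjRow A) [] L := by
  classical
  let e : Fin L.length ≃ W := hL.getEquivOfForallMemList L hmem
  let J : ParamGraph := ⟨L.length, A.comap e, k⟩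
  refine ⟨J, rfl, ⟨SimpleGraph.Iso.comap e A⟩, ?_⟩
  rw [J.encode_eq, ← flatMapBefore_map_nil (F := adjRow A) (p := [])
    (adjRow_embedding (SimpleGraph.Iso.comap e A).toEmbedding)]
  congr 2
  exact List.map_get_finRange L

end adjRow

namespace GadgetFamily

variable (D : GadgetFamily)

/-- The new vertices in the groups of a list. -/
def groupVertices (G : List D.Group) : List (D.Group × Fin D.size) :=
  G.flatMap fun g => (List.finRange D.size).map (Prod.mk g)

open Classical in
/-- The row of a new vertex after the rows of a graph and of the new vertices of the list `p`. -/
noncomputable def vertexRow (y : D.Group × Fin D.size) (p : List (D.Group × Fin D.size)) :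
    List (Option Bool) :=
  none :: (fillMarks (D.old y.1.shape y.2) y.1.word ++
    p.map fun z => decide (y.1 = z.1) && D.new y.2 z.2).map some

variable {D} {G : List D.Group} {g : D.Group}

theorem mem_groupVertices {y : D.Group × Fin D.size} : y ∈ D.groupVertices G ↔ y.1 ∈ G := by
  obtain ⟨g, x⟩ := y
  simp [groupVertices]

theorem nodup_groupVertices (hG : G.Nodup) : (D.groupVertices G).Nodup := by
  rw [groupVertices, List.nodup_flatMap]
  refine ⟨fun g _ => (List.nodup_finRange _).map (Prod.mk_right_injective g), hG.imp ?_⟩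
  intro g g' hg y hy hy'
  obtain ⟨x, -, rfl⟩ := List.mem_map.1 hy
  obtain ⟨x', -, hx'⟩ := List.mem_map.1 hy'
  exact hg (congrArg Prod.fst hx').symm

theorem length_groupVertices : (D.groupVertices G).length = D.size * G.length := by
  simp [groupVertices, List.length_flatMap, mul_comm]

open Classical in
theorem vertexRow_groupVertices_append (hg : g ∉ G) (x : Fin D.size) (ys : List (Fin D.size)) :
    D.vertexRow (g, x) (D.groupVertices G ++ ys.map (Prod.mk g)) =
      none :: (fillMarks (D.old g.shape x) g.word ++
        List.replicate (D.size * G.length) false ++ ys.map (D.new x)).map some := by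
  have hfalse : ((D.groupVertices G).map fun z => decide (g = z.1) && D.new x z.2) =
      List.replicate (D.size * G.length) false := by
    refine List.eq_replicate_iff.2 ⟨by rw [List.length_map, length_groupVertices], ?_⟩
    simp only [List.mem_map, forall_exists_index, and_imp]
    rintro _ z hz rfl
    have hne : g ≠ z.1 := fun h => hg (h ▸ mem_groupVertices.1 hz)
    simp [hne]
  rw [vertexRow, List.map_append (l₁ := D.groupVertices G), hfalse, List.append_assoc]
  simp [Function.comp_def]

theorem flatMapBefore_vertexRow_group (hg : g ∉ G) :
    flatMapBefore D.vertexRow (D.groupVertices G) ((List.finRange D.size).map (Prod.mk g)) =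
      D.groupWord (D.size * G.length) g := by
  rw [flatMapBefore_map_nil (vertexRow_groupVertices_append hg), ← flatMap_filter_lt_finRange]
  rfl

theorem flatMapBefore_vertexRow (hG : G.Nodup) :
    flatMapBefore D.vertexRow [] (D.groupVertices G) = D.groupsWord G := by
  induction G using List.reverseRecOn with
  | nil => rfl
  | append_singleton G g ih =>
    have hg : g ∉ G := fun h => (List.nodup_append.1 hG).2.2 g h g (by simp) rfl
    rw [groupsWord_concat, ← flatMapBefore_vertexRow_group hg, ← ih (List.nodup_append.1 hG).1]
    simp [groupVertices, List.flatMap_append, flatMapBefore_append]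

variable (D)

/-- The new vertices of the groups for a graph with `n` vertices and the parameter `k`. -/
abbrev NewVertex (k n : ℕ) := {y // y ∈ D.groupVertices (D.allGroups k n)}

/-- A new vertex is given by a word of marks, a shape, the number of the set of new vertices, and
the position in this set. -/
def groupVerticesEquiv (k n : ℕ) :
    D.NewVertex k n ≃ (MarkWord n D.arity × D.Shape) × Fin (k + 1) × Fin D.size where
  toFun y :=
    have hy := mem_allGroups.1 (mem_groupVertices.1 y.2)
    ((⟨y.1.1.word, hy.1⟩, y.1.1.shape), ⟨y.1.1.copy, hy.2⟩, y.1.2)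
  invFun z := ⟨(⟨z.1.1, z.1.2, z.2.1⟩, z.2.2),
    mem_groupVertices.2 (mem_allGroups.2 ⟨z.1.1.2, z.2.1.2⟩)⟩
  left_inv _ := rfl
  right_inv _ := rfl

end GadgetFamily

/-! ### The reduction -/

section reduction

variable {V : Type*} (H : SimpleGraph V) (S : Set V)

/-- The copies of `H[S]` in a complete graph are given by the words of marks and the shapes. -/
noncomputable def markedSubgraphEquiv (n : ℕ) :
    MarkWord n (Nat.card S) × IsoGraph (H.induce S) (Nat.card S) ≃
      CopyInComplete (H.induce S) (Fin n) :=
  Equiv.ofBijective _ ⟨markedSubgraph_injective, markedSubgraph_surjective rfl⟩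

theorem exists_iso_markedCopy {n : ℕ} (C : CopyInComplete (H.induce S) (Fin n)) :
    ∃ ψ : H.induce S ≃g C.1.coe, ∀ y, (ψ y : Fin n) =
      markedCopy ((markedSubgraphEquiv H S n).symm C).1
        ((markedSubgraphEquiv H S n).symm C).2 y := by
  obtain ⟨y, rfl⟩ := (markedSubgraphEquiv H S n).surjective C
  rw [Equiv.symm_apply_apply]
  exact ⟨(markedCopy y.1 y.2).isoToSubgraph, fun _ => rfl⟩

/-- The identification of `H[S]` with a copy `C` that the machine uses: `φ_C` in the paper. -/
noncomputable def markedIso {n : ℕ} (C : CopyInComplete (H.induce S) (Fin n)) :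
    H.induce S ≃g C.1.coe := (exists_iso_markedCopy H S C).choose

theorem markedIso_markedSubgraphEquiv {n : ℕ}
    (y : MarkWord n (Nat.card S) × IsoGraph (H.induce S) (Nat.card S)) (z : S) :
    (markedIso H S (markedSubgraphEquiv H S n y) z : Fin n) = markedCopy y.1 y.2 z := by
  rw [markedIso, (exists_iso_markedCopy H S _).choose_spec, Equiv.symm_apply_apply]

/-- The graph that the machine constructs. -/
noncomputable abbrev attachedGraph {n : ℕ} (k : ℕ) (G' : SimpleGraph (Fin n)) :
    SimpleGraph (Fin n ⊕ (CopyInComplete (H.induce S) (Fin n) × Fin (k + 1) × ↥Sᶜ)) :=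
  attachCopies H S (k + 1) G' (markedIso H S)

variable [Finite V]

/-- The numbering of the vertices outside `S`. -/
noncomputable def complEquiv : ↥Sᶜ ≃ Fin (Nat.card ↥Sᶜ) := Finite.equivFin _

open Classical in
/-- The data of the machine that attaches copies of `H` at the copies of `H[S]`. -/
noncomputable def attachGadgets : GadgetFamily where
  arity := Nat.card S
  size := Nat.card ↥Sᶜ
  Shape := IsoGraph (H.induce S) (Nat.card S)
  shapes := Finset.univ.toList
  old K x := List.ofFn fun j => decide (H.Adj (K.2.some.symm j) ((complEquiv S).symm x))
  new x y := decide (H.Adj ((complEquiv S).symm x) ((complEquiv S).symm y))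
  mem_shapes _ := Finset.mem_toList.2 (Finset.mem_univ _)
  nodup_shapes := Finset.nodup_toList _
  length_old _ _ := List.length_ofFn

/-- The new vertices of the machine are those of the graph with attached copies. -/
noncomputable def newVertexEquiv (k n : ℕ) :
    (attachGadgets H S).NewVertex k n ≃
      CopyInComplete (H.induce S) (Fin n) × Fin (k + 1) × ↥Sᶜ :=
  ((attachGadgets H S).groupVerticesEquiv k n).trans <|
    (markedSubgraphEquiv H S n).prodCongr <| (Equiv.refl _).prodCongr (complEquiv S).symm

variable {H S}

/-- The word of marks and the shape that give the copy to which a new vertex is attached. -/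
noncomputable def newVertexCopy {k n : ℕ} (y : (attachGadgets H S).NewVertex k n) :
    MarkWord n (Nat.card S) × IsoGraph (H.induce S) (Nat.card S) :=
  ((attachGadgets H S).groupVerticesEquiv k n y).1

variable {n k : ℕ} {G' : SimpleGraph (Fin n)}

open Classical in
theorem fillMarks_old (w : MarkWord n (Nat.card S)) (K : IsoGraph (H.induce S) (Nat.card S))
    (x : Fin (Nat.card ↥Sᶜ)) :
    fillMarks ((attachGadgets H S).old K x) w.1 = (List.finRange n).map fun u =>
      decide (∃ y : S, markedCopy w K y = u ∧ H.Adj y ((complEquiv S).symm x)) := by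
  refine List.ext_getElem (by simp [w.2.1]) fun u hu hu' => ?_
  have hn : u < n := by simpa using hu'
  rw [getElem_fillMarks _ _ _ (by simpa using hu), List.getElem_map, List.getElem_finRange,
    Bool.eq_iff_iff, Bool.and_eq_true, decide_eq_true_iff, ← exists_prop]
  refine .trans (exists_congr fun hmarked => ?_)
    (exists_markedCopy_eq_and_iff w K (u := ⟨u, hn⟩) (p := fun y => H.Adj y _)).symm
  have hlt : (w.1.take u).count true < Nat.card S := w.count_take_lt (u := ⟨u, hn⟩) hmarked
  simp only [attachGadgets, List.getD_eq_getElem?_getD, List.getElem?_ofFn, dif_pos hlt,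
    Option.getD_some, decide_eq_true_iff]
  rfl

theorem attachedGraph_adj_newVertexEquiv_inl (y : (attachGadgets H S).NewVertex k n) (u : Fin n) :
    (attachedGraph H S k G').Adj (.inr (newVertexEquiv H S k n y)) (.inl u) ↔
      ∃ z : S, markedCopy (newVertexCopy y).1 (newVertexCopy y).2 z = u ∧
        H.Adj z ((complEquiv S).symm y.1.2) := by
  simp only [← markedIso_markedSubgraphEquiv]
  rfl

theorem attachedGraph_adj_newVertexEquiv_inr (y z : (attachGadgets H S).NewVertex k n) :
    (attachedGraph H S k G').Adj (.inr (newVertexEquiv H S k n y))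
        (.inr (newVertexEquiv H S k n z)) ↔
      y.1.1 = z.1.1 ∧ H.Adj ((complEquiv S).symm y.1.2) ((complEquiv S).symm z.1.2) := by
  change markedSubgraphEquiv H S n (newVertexCopy y) = markedSubgraphEquiv H S n (newVertexCopy z) ∧
    _ = _ ∧ _ ↔ _
  rw [EmbeddingLike.apply_eq_iff_eq, ← and_assoc]
  refine and_congr_left' ⟨fun ⟨hcopy, hindex⟩ => ?_, fun h => ?_⟩
  · exact GadgetFamily.Group.ext (congrArg (fun w => w.1.1) hcopy) (congrArg (fun w => w.2) hcopy)
      (congrArg Fin.val hindex)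
  · exact ⟨Prod.ext (Subtype.ext (congrArg (·.word) h)) (congrArg (·.shape) h),
      Fin.ext (congrArg (·.copy) h)⟩

theorem adjRow_newVertexEquiv (y : (attachGadgets H S).NewVertex k n)
    (l : List ((attachGadgets H S).NewVertex k n)) :
    adjRow (attachedGraph H S k G') (.inr (newVertexEquiv H S k n y))
        ((List.finRange n).map .inl ++ l.map fun z => .inr (newVertexEquiv H S k n z)) =
      (attachGadgets H S).vertexRow y.1 (l.map Subtype.val) := by
  classical
  have hold : fillMarks ((attachGadgets H S).old y.1.1.shape y.1.2) y.1.1.word = _ :=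
    fillMarks_old (newVertexCopy y).1 (newVertexCopy y).2 y.1.2
  rw [adjRow, GadgetFamily.vertexRow, hold]
  simp only [List.map_append, List.map_map]
  congr 2
  · refine List.map_congr_left fun u _ => ?_
    simp only [Function.comp_apply, attachedGraph_adj_newVertexEquiv_inl]
  · refine List.map_congr_left fun z _ => ?_
    simp only [Function.comp_apply, attachedGraph_adj_newVertexEquiv_inr, Bool.decide_and]
    rfl

variable (H S)

/-- The vertices of the graph with attached copies, in the order of the machine's output. -/
noncomputable def attachedVertices (k n : ℕ) :
    List (Fin n ⊕ (CopyInComplete (H.induce S) (Fin n) × Fin (k + 1) × ↥Sᶜ)) :=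
  (List.finRange n).map .inl ++
    ((attachGadgets H S).groupVertices ((attachGadgets H S).allGroups k n)).attach.map
      fun y => .inr (newVertexEquiv H S k n y)

theorem nodup_attachedVertices (k n : ℕ) : (attachedVertices H S k n).Nodup := by
  have hnew := GadgetFamily.nodup_groupVertices ((attachGadgets H S).nodup_allGroups k n)
  refine .append ((List.nodup_finRange _).map Sum.inl_injective) ((List.nodup_attach.2 hnew).map
    (Sum.inr_injective.comp (newVertexEquiv H S k n).injective)) ?_
  simp [List.Disjoint]

theorem mem_attachedVertices {k n : ℕ}
    (v : Fin n ⊕ (CopyInComplete (H.induce S) (Fin n) × Fin (k + 1) × ↥Sᶜ)) :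
    v ∈ attachedVertices H S k n := by
  rcases v with u | p
  · exact List.mem_append_left _ (List.mem_map_of_mem (List.mem_finRange u))
  · obtain ⟨y, rfl⟩ := (newVertexEquiv H S k n).surjective p
    exact List.mem_append_right _ (List.mem_map_of_mem (List.mem_attach _ y))

theorem flatMapBefore_adjRow_attachedVertices (k : ℕ) (G' : SimpleGraph (Fin n)) :
    flatMapBefore (adjRow (attachedGraph H S k G')) [] (attachedVertices H S k n) =
      flatMapBefore (adjRow G') [] (List.finRange n) ++
        (attachGadgets H S).groupsWord ((attachGadgets H S).allGroups k n) := by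
  rw [attachedVertices, flatMapBefore_append]
  congr 1
  · exact flatMapBefore_map_nil (adjRow_embedding (attachCopiesInl H S _ G' _)) _
  · conv_rhs =>
      rw [← GadgetFamily.flatMapBefore_vertexRow ((attachGadgets H S).nodup_allGroups k n),
        ← List.attach_map_subtype_val ((attachGadgets H S).groupVertices _),
        flatMapBefore_map_nil fun _ _ => rfl]
    exact flatMapBefore_map_nil adjRow_newVertexEquiv _

theorem exists_instance (I : ParamGraph) :
    ∃ J : ParamGraph, J.k = I.k ∧ Nonempty (J.graph ≃g attachedGraph H S I.k I.graph) ∧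
      J.encode = I.encode ++
        (attachGadgets H S).groupsWord ((attachGadgets H S).allGroups I.k I.n) := by
  rw [I.encode_eq, List.append_assoc, ← flatMapBefore_adjRow_attachedVertices]
  exact ParamGraph.exists_encode_eq_flatMapBefore _ _ (nodup_attachedVertices H S _ _)
    (mem_attachedVertices H S)

end reduction

theorem mainTheorem7 {V : Type*} [Fintype V] (H : SimpleGraph V) [DecidableRel H.Adj] (d : ℤ)
    (V' : Set V) (hV' : V' = {v | d < (H.degree v : ℤ)}) (kind : ModificationKind) :
    ∃ f : ParamGraph → ParamGraph,
      IsLinearParameterizedReduction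
        (FreeEdgeModification (H.induce V') kind) (FreeEdgeModification H kind) f ∧
      ∀ I : ParamGraph,
        ∃ φ : ∀ C : CopyInComplete (H.induce V') (Fin I.n), H.induce V' ≃g C.1.coe,
          Nonempty ((f I).graph ≃g attachCopies H V' (I.k + 1) I.graph φ) := by
  have hdegree : ∀ v ∈ V', ∀ x ∉ V', H.degree x < H.degree v := by
    subst hV'
    intro v hv x hx
    exact Int.ofNat_lt.1 ((not_lt.1 hx).trans_lt hv)
  choose f hk he hencode using exists_instance H V'
  refine ⟨f, ⟨GadgetFamily.nonempty_computableInPolyTime hencode, fun I => ?_, 1, fun I => ?_⟩,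
    fun I => ⟨_, he I⟩⟩
  · change CanModify (H.induce V') kind I.graph I.k ↔ CanModify H kind (f I).graph (f I).k
    rw [hk, CanModify.iso_iff (he I).some]
    exact ⟨.attachCopies hdegree, .of_attachCopies (Nat.lt_succ_self _)⟩
  · rw [hk, one_mul]
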